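/- Let $d\ge 3$ be an integer and let $p\ge 1$ be real. Let $\mu$ be a Poisson point process of intensity one on $\mathbb{R}^d$. For a rectangle $R=x+\prod_{i=1}^d[0,L_i]$ with $x\in\mathbb{R}^d$ and $L_1,\dots,L_d>0$, put $\kappa_R=\mu(R)/|R|$, where $|\cdot|$ is Lebesgue measure, and \[ f^{\mathrm{ref}}(R)=\mathbb{E}\left[\frac{1}{|R|}\,W_p^p\bigl(\mu|_R,\ \kappa_R\,\mathrm{Leb}|_R\bigr)\right]\in[0,\infty], \qquad W_p^p(\alpha,\beta)=\inf_{\pi}\int |y-z|^p\,d\pi(y,z), \] where $|y-z|$ is the Euclidean distance and the infimum runs over all measures $\pi$ on $\mathbb{R}^d\times\mathbb{R}^d$ with marginals $\alpha$ and $\beta$. For $L>0$ write $f^{\mathrm{ref}}(L)=f^{\mathrm{ref}}([0,L]^d)$. The rectangle $R$ is said to be of moderate aspect ratio if $L_i/L_j\le 2$ for all $i,j$. There is a constant $C>0$ depending only on $d$ and $p$ such that: 1. for every real $L\ge 1$ and every integer $m\ge 1$, \[ f^{\mathrm{ref}}(mL)\le f^{\mathrm{ref}}(L)+\frac{C}{L^{\frac{d-2}{2}}};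 \] 2. for every rectangle $R$ of moderate aspect ratio, the random cost $\frac{1}{|R|}W_p^p(\mu|_R,\kappa_R\,\mathrm{Leb}|_R)$ is measurable (up to a null set), and $f^{\mathrm{ref}}(R)\le C$. -/

import Mathlib

open MeasureTheory ProbabilityTheory
open scoped ENNReal NNReal

namespace PoissonMatching

/-- `π` is a coupling of `μ` and `ν`: a measure on the product with marginals `μ` and `ν`. -/
def IsCoupling {E : Type*} [MeasurableSpace E] (π : Measure (E × E)) (μ ν : Measure E) : Prop :=
  π.map Prod.fst = μ ∧ π.map Prod.snd = ν

/-- The transportation cost `W_p^p(μ, ν) = inf_π ∫ |x - y|^p dπ(x, y)`, the infimum being over all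
couplings of `μ` and `ν`. It is `0` if `μ = ν = 0`, and `∞` if the masses differ (no coupling). -/
noncomputable def transportCost {E : Type*} [MeasurableSpace E] [PseudoEMetricSpace E]
    (p : ℝ) (μ ν : Measure E) : ℝ≥0∞ :=
  ⨅ (π : Measure (E × E)) (_ : IsCoupling π μ ν), ∫⁻ z, edist z.1 z.2 ^ p ∂π

/-- The cost `W^p_A(μ, ν)` between the restrictions of `μ` and `ν` to `A`. -/
noncomputable def transportCostOn {E : Type*} [MeasurableSpace E] [PseudoEMetricSpace E]
    (p : ℝ) (A : Set E) (μ ν : Measure E) : ℝ≥0∞ :=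
  transportCost p (μ.restrict A) (ν.restrict A)

/-- `μ` is a Poisson point process of intensity one on `ℝ^d`, defined on `(Ω, P)`: a random
locally finite atomic measure `∑ δ_{X_i}` whose values on disjoint Borel sets are independent,
and whose value on a Borel set `A` of finite volume is a Poisson variable of parameter `|A|`.
(For `|A| = ∞` it follows that the value on `A` is a.s. infinite.) -/
structure IsPoissonPointProcess {d : ℕ} {Ω : Type*} [MeasurableSpace Ω] (P : Measure Ω)
    (μ : Ω → Measure (EuclideanSpace ℝ (Fin d))) : Prop where
  measurable : Measurable μ
  locallyFinite : ∀ ω, IsLocallyFiniteMeasure (μ ω)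
  atomic : ∀ ω, ∃ (I : Set ℕ) (X : ℕ → EuclideanSpace ℝ (Fin d)),
    μ ω = Measure.sum fun i : I => Measure.dirac (X i)
  indep : ∀ (k : ℕ) (A : Fin k → Set (EuclideanSpace ℝ (Fin d))),
    (∀ i, MeasurableSet (A i)) → Pairwise (Function.onFun Disjoint A) →
      iIndepFun (fun i ω => μ ω (A i)) P
  law : ∀ A : Set (EuclideanSpace ℝ (Fin d)), MeasurableSet A → volume A ≠ ∞ →
    P.map (fun ω => μ ω A) =
      (poissonMeasure (volume A).toNNReal).map (fun n : ℕ => (n : ℝ≥0∞))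

/-- The rectangle `x + ∏ i, [0, ℓ i]` in `ℝ^d`. -/
def rectangle {d : ℕ} (x : EuclideanSpace ℝ (Fin d)) (ℓ : Fin d → ℝ) :
    Set (EuclideanSpace ℝ (Fin d)) :=
  {y | ∀ i, x i ≤ y i ∧ y i ≤ x i + ℓ i}

/-- The cube `Q_L = [0, L]^d`. -/
def cube (d : ℕ) (L : ℝ) : Set (EuclideanSpace ℝ (Fin d)) :=
  rectangle 0 fun _ => L

/-- A (nondegenerate) rectangle with side lengths `ℓ` is of moderate aspect ratio. -/
def ModerateAspectRatio {d : ℕ} (ℓ : Fin d → ℝ) : Prop :=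
  (∀ i, 0 < ℓ i) ∧ ∀ i j, ℓ i / ℓ j ≤ 2

/-- `|R|⁻¹ W^p_R(μ, κ)`, with `κ = μ(R) / |R|` standing for the measure with that constant
density with respect to Lebesgue measure. -/
noncomputable def refCost {d : ℕ} (p : ℝ) (R : Set (EuclideanSpace ℝ (Fin d)))
    (μ : Measure (EuclideanSpace ℝ (Fin d))) : ℝ≥0∞ :=
  (volume R)⁻¹ * transportCostOn p R μ ((μ R / volume R) • volume)

/-- `f^ref(R) = 𝔼[|R|⁻¹ W^p_R(μ, κ)]`, as an expectation with values in `[0, ∞]`. -/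
noncomputable def fref {d : ℕ} {Ω : Type*} [MeasurableSpace Ω] (P : Measure Ω)
    (μ : Ω → Measure (EuclideanSpace ℝ (Fin d))) (p : ℝ)
    (R : Set (EuclideanSpace ℝ (Fin d))) : ℝ≥0∞ :=
  ∫⁻ ω, refCost p R (μ ω) ∂P

end PoissonMatching

namespace PoissonMatching

/-! ### Couplings, transport cost, and the triangle inequality for its root -/

section Transport

variable {E : Type*} [MeasurableSpace E]

/-! The estimates are made on the root F(R) = `fref`(R)^(1/p), because W_p obeys a triangle
inequality. Cut a rectangle R of volume V across a side of length ℓ, at the fraction θ. Match the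
points of each part to the uniform measure of the same mass on that part; the two costs add. What
remains is to pass from two densities to one: stretch the parts affinely so that the interface moves
from θℓ to (n₁/n)ℓ, where n₁ and n count the points of the first part and of R
(`transportCost_split_le`). The p-th central moments of these counts are of order V^(p/2)
(`exists_lintegral_poissonMeasure_abs_sub_rpow_le`), so after division by V and extraction of the
root, F(R) is at most the larger F of the parts plus Cℓ V^(-1/2) (`exists_fref_split_le`).

When all side ratios are at most 3, ℓ is at most a constant times V^(1/d), and the error is of order
V^(-β) with β = 1/2 - 1/d. Since d ≥ 3, β is positive, so the errors of successive cuts form a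
geometric series dominated by the smallest scale. `exists_fref_potential_step` sums it through a
potential that each cut preserves.

This is used twice. Halving the longest side down to volume at most 2, where the diameter bound
suffices, gives the uniform bound (`exists_fref_le`). Cutting [0, mL]^d along the grid of mesh L
down to single cells, whose volume is L^d, leaves an error L^(-dβ) = L^(-(d-2)/2) between the roots
(`exists_fref_root_le`); the uniform bound then turns roots into p-th powers.

All cells have at most the expected cost of [0, L]^d, by stationarity. Both this and measurability
rest on one approximation: up to a small error, the cost is a function of the numbers of points in
finitely many disjoint Borel sets (`exists_approx_by_counts`), whose joint law is prescribed. -/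

theorem IsCoupling.add {π₁ π₂ : Measure (E × E)} {μ₁ μ₂ ν₁ ν₂ : Measure E}
    (h₁ : IsCoupling π₁ μ₁ ν₁) (h₂ : IsCoupling π₂ μ₂ ν₂) :
    IsCoupling (π₁ + π₂) (μ₁ + μ₂) (ν₁ + ν₂) :=
  ⟨by rw [Measure.map_add _ _ measurable_fst, h₁.1, h₂.1],
    by rw [Measure.map_add _ _ measurable_snd, h₁.2, h₂.2]⟩

theorem IsCoupling.map_prodMk {F : Type*} [MeasurableSpace F] (η : Measure F) {f g : F → E}
    (hf : Measurable f) (hg : Measurable g) :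
    IsCoupling (η.map fun u => (f u, g u)) (η.map f) (η.map g) :=
  ⟨by rw [Measure.map_map measurable_fst (hf.prodMk hg)]; rfl,
    by rw [Measure.map_map measurable_snd (hf.prodMk hg)]; rfl⟩

/-- Gluing of two couplings along their common marginal. -/
theorem exists_gluing [StandardBorelSpace E] {π₁ π₂ : Measure (E × E)} [IsFiniteMeasure π₁]
    [IsFiniteMeasure π₂] {μ ν ρ : Measure E} (h₁ : IsCoupling π₁ μ ν) (h₂ : IsCoupling π₂ ν ρ) :
    ∃ γ : Measure (E × E × E), γ.map (fun t => (t.2.1, t.1)) = π₁ ∧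
      γ.map (fun t => (t.1, t.2.2)) = π₂ := by
  rcases isEmpty_or_nonempty E with hE | hE
  · exact ⟨0, Subsingleton.elim _ _, Subsingleton.elim _ _⟩
  set π₁' := π₁.map Prod.swap with hπ₁'
  have e₁ : π₁'.fst = ν := by
    rw [Measure.fst, hπ₁', Measure.map_map measurable_fst measurable_swap, ← h₁.2]; rfl
  have e₂ : π₂.fst = ν := h₂.1
  have d₁ := π₁'.disintegrate π₁'.condKernel
  have d₂ := π₂.disintegrate π₂.condKernel
  have : IsFiniteMeasure ν := e₂ ▸ inferInstance
  rw [e₁] at d₁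
  rw [e₂] at d₂
  -- Conditionally on the common coordinate, the two outer coordinates are drawn independently from
  -- the two disintegrations.
  refine ⟨ν ⊗ₘ (π₁'.condKernel ×ₖ π₂.condKernel), ?_, ?_⟩
  · have : (ν ⊗ₘ (π₁'.condKernel ×ₖ π₂.condKernel)).map (Prod.map id Prod.fst) = π₁' := by
      rw [← Measure.compProd_map measurable_fst, ← Kernel.fst_eq, Kernel.fst_prod, d₁]
    have h : π₁ = π₁'.map Prod.swap := by
      rw [hπ₁', Measure.map_map measurable_swap measurable_swap]; simp
    refine Eq.trans ?_ ((congrArg (Measure.map Prod.swap) this).trans h.symm)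
    rw [Measure.map_map measurable_swap (by fun_prop)]
    rfl
  · have : (ν ⊗ₘ (π₁'.condKernel ×ₖ π₂.condKernel)).map (Prod.map id Prod.snd) = π₂ := by
      rw [← Measure.compProd_map measurable_snd, ← Kernel.snd_eq, Kernel.snd_prod, d₂]
    exact this

variable [PseudoEMetricSpace E]

theorem transportCost_le {p : ℝ} {μ ν : Measure E} {π : Measure (E × E)}
    (h : IsCoupling π μ ν) : transportCost p μ ν ≤ ∫⁻ z, edist z.1 z.2 ^ p ∂π :=
  iInf₂_le π h

theorem transportCost_add_le (p : ℝ) (μ₁ μ₂ ν₁ ν₂ : Measure E) :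
    transportCost p (μ₁ + μ₂) (ν₁ + ν₂) ≤ transportCost p μ₁ ν₁ + transportCost p μ₂ ν₂ := by
  rw [transportCost.eq_def p μ₁, transportCost.eq_def p μ₂]
  simp only [ENNReal.iInf_add, ENNReal.add_iInf]
  refine le_iInf₂ fun π₂ h₂ => le_iInf₂ fun π₁ h₁ => ?_
  refine (transportCost_le (h₁.add h₂)).trans (le_of_eq ?_)
  rw [lintegral_add_measure]

@[simp]
theorem transportCost_zero (p : ℝ) : transportCost p (0 : Measure E) 0 = 0 := by
  have h : IsCoupling (0 : Measure (E × E)) 0 0 := ⟨by simp, by simp⟩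
  simpa using transportCost_le (p := p) h

/-- A common reference measure pushed forward by two maps a bounded distance apart. -/
theorem transportCost_map_le [OpensMeasurableSpace E] [SecondCountableTopology E]
    {F : Type*} [MeasurableSpace F] {p : ℝ} (hp : 0 ≤ p)
    (η : Measure F) {f g : F → E} (hf : Measurable f) (hg : Measurable g) {δ : ℝ≥0∞}
    (h : ∀ᵐ u ∂η, edist (f u) (g u) ≤ δ) :
    transportCost p (η.map f) (η.map g) ≤ δ ^ p * η Set.univ := by
  refine (transportCost_le (IsCoupling.map_prodMk η hf hg)).trans ?_
  rw [lintegral_map (by fun_prop) (hf.prodMk hg)]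
  calc ∫⁻ u, edist (f u) (g u) ^ p ∂η ≤ ∫⁻ _, δ ^ p ∂η :=
        lintegral_mono_ae (h.mono fun u hu => ENNReal.rpow_le_rpow hu hp)
    _ = _ := by rw [lintegral_const]

/-- The normalized product measure is a coupling, and it moves nothing farther than the diameter. -/
theorem transportCost_le_of_edist_le {p : ℝ} (hp : 0 ≤ p)
    {μ ν : Measure E} [IsFiniteMeasure μ] [IsFiniteMeasure ν] (hm : μ Set.univ = ν Set.univ)
    {A : Set E} (hμ : ∀ᵐ x ∂μ, x ∈ A) (hν : ∀ᵐ x ∂ν, x ∈ A) {δ : ℝ≥0∞}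
    (hδ : ∀ x ∈ A, ∀ y ∈ A, edist x y ≤ δ) :
    transportCost p μ ν ≤ δ ^ p * μ Set.univ := by
  by_cases h0 : μ Set.univ = 0
  · have h1 := Measure.measure_univ_eq_zero.1 h0
    have h2 := Measure.measure_univ_eq_zero.1 (hm.symm.trans h0)
    simp [h1, h2]
  have hfin := measure_ne_top μ Set.univ
  have hc : IsCoupling ((μ Set.univ)⁻¹ • μ.prod ν) μ ν := by
    constructor
    · rw [Measure.map_smul, Measure.map_fst_prod, ← hm, smul_smul,
        ENNReal.inv_mul_cancel h0 hfin, one_smul]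
    · rw [Measure.map_smul, Measure.map_snd_prod, smul_smul,
        ENNReal.inv_mul_cancel h0 hfin, one_smul]
  refine (transportCost_le hc).trans ?_
  have h1 : ∀ᵐ z ∂(μ.prod ν), z.1 ∈ A ∧ z.2 ∈ A :=
    (Measure.quasiMeasurePreserving_fst.ae hμ).and (Measure.quasiMeasurePreserving_snd.ae hν)
  rw [lintegral_smul_measure]
  calc (μ Set.univ)⁻¹ • ∫⁻ z, edist z.1 z.2 ^ p ∂(μ.prod ν)
      ≤ (μ Set.univ)⁻¹ • ∫⁻ _, δ ^ p ∂(μ.prod ν) := by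
        gcongr ?_ • ?_
        exact lintegral_mono_ae (h1.mono fun z hz => ENNReal.rpow_le_rpow (hδ _ hz.1 _ hz.2) hp)
    _ = δ ^ p * μ Set.univ := by
        rw [lintegral_const, ← Set.univ_prod_univ, Measure.prod_prod, ← hm, smul_eq_mul,
          mul_left_comm, ← mul_assoc (μ Set.univ)⁻¹, ENNReal.inv_mul_cancel h0 hfin, one_mul]

/-- The transportation distance, the `p`-th root of the cost. -/
noncomputable def transportDist (p : ℝ) (μ ν : Measure E) : ℝ≥0∞ :=
  transportCost p μ ν ^ (1 / p)

theorem transportDist_eq_iInf {p : ℝ} (hp : 0 < p) (μ ν : Measure E) :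
    transportDist p μ ν =
      ⨅ (π : Measure (E × E)) (_ : IsCoupling π μ ν), (∫⁻ z, edist z.1 z.2 ^ p ∂π) ^ (1 / p) := by
  change ENNReal.orderIsoRpow (1 / p) (one_div_pos.2 hp) (transportCost p μ ν) = _
  simp only [transportCost, OrderIso.map_iInf]
  rfl

/-- Glue the two couplings along `ν` and apply Minkowski's inequality in L^p of the glued measure.
-/
theorem transportDist_triangle [StandardBorelSpace E] [OpensMeasurableSpace E]
    [SecondCountableTopology E] {p : ℝ} (hp : 1 ≤ p) (μ ν ρ : Measure E)
    [IsFiniteMeasure μ] [IsFiniteMeasure ν] :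
    transportDist p μ ρ ≤ transportDist p μ ν + transportDist p ν ρ := by
  have hp0 : 0 < p := by linarith
  simp only [transportDist_eq_iInf hp0 μ ν, transportDist_eq_iInf hp0 ν ρ,
    ENNReal.iInf_add, ENNReal.add_iInf]
  refine le_iInf₂ fun π₂ h₂ => le_iInf₂ fun π₁ h₁ => ?_
  have hf : ∀ (π : Measure (E × E)) (η : Measure E) [IsFiniteMeasure η],
      π.map Prod.fst = η → IsFiniteMeasure π := by
    intro π η _ h
    constructor
    have : π Set.univ = η Set.univ := by
      rw [← h, Measure.map_apply measurable_fst MeasurableSet.univ, Set.preimage_univ]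
    rw [this]
    exact measure_lt_top _ _
  have := hf π₁ μ h₁.1
  have := hf π₂ ν h₂.1
  obtain ⟨γ, g₁, g₂⟩ := exists_gluing h₁ h₂
  have hc : IsCoupling (γ.map fun t => (t.2.1, t.2.2)) μ ρ := by
    constructor
    · rw [Measure.map_map measurable_fst (by fun_prop), ← h₁.1, ← g₁,
        Measure.map_map measurable_fst (by fun_prop)]
      rfl
    · rw [Measure.map_map measurable_snd (by fun_prop), ← h₂.2, ← g₂,
        Measure.map_map measurable_snd (by fun_prop)]
      rfl
  calc transportDist p μ ρ
      ≤ (∫⁻ z, edist z.1 z.2 ^ p ∂(γ.map fun t => (t.2.1, t.2.2))) ^ (1 / p) :=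
        ENNReal.rpow_le_rpow (transportCost_le hc) (by positivity)
    _ = (∫⁻ t, edist t.2.1 t.2.2 ^ p ∂γ) ^ (1 / p) := by
        rw [lintegral_map (by fun_prop) (by fun_prop)]
    _ ≤ (∫⁻ t, ((fun t : E × E × E => edist t.2.1 t.1) +
          fun t : E × E × E => edist t.1 t.2.2) t ^ p ∂γ) ^ (1 / p) := by
        gcongr with t
        exact edist_triangle _ _ _
    _ ≤ (∫⁻ t, edist t.2.1 t.1 ^ p ∂γ) ^ (1 / p) + (∫⁻ t, edist t.1 t.2.2 ^ p ∂γ) ^ (1 / p) :=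
        ENNReal.lintegral_Lp_add_le (by fun_prop) (by fun_prop) hp
    _ = _ := by
        rw [← g₁, ← g₂, lintegral_map (by fun_prop) (by fun_prop),
          lintegral_map (by fun_prop) (by fun_prop)]

end Transport

/-! ### Rectangles and their uniform measures -/

section Rectangles

variable {d : ℕ}

theorem rectangle_eq_preimage (x : EuclideanSpace ℝ (Fin d)) (ℓ : Fin d → ℝ) :
    rectangle x ℓ = WithLp.ofLp ⁻¹' Set.Icc (WithLp.ofLp x) (WithLp.ofLp x + ℓ) := by
  ext y
  simp [rectangle, Pi.le_def, forall_and]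

theorem isClosed_rectangle (x : EuclideanSpace ℝ (Fin d)) (ℓ : Fin d → ℝ) :
    IsClosed (rectangle x ℓ) := by
  rw [rectangle_eq_preimage]
  exact isClosed_Icc.preimage (PiLp.continuous_ofLp 2 _)

theorem measurableSet_rectangle (x : EuclideanSpace ℝ (Fin d)) (ℓ : Fin d → ℝ) :
    MeasurableSet (rectangle x ℓ) :=
  (isClosed_rectangle x ℓ).measurableSet

theorem dist_le_of_forall_abs_sub_le {x y : EuclideanSpace ℝ (Fin d)} {s : ℝ} (hs : 0 ≤ s)
    (h : ∀ i, |x i - y i| ≤ s) : dist x y ≤ d * s := by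
  rw [EuclideanSpace.dist_eq]
  refine Real.sqrt_le_iff.2 ⟨by positivity, ?_⟩
  calc ∑ i, dist (x i) (y i) ^ 2 ≤ ∑ _i : Fin d, s ^ 2 := by
        gcongr with i
        exact h i
    _ = d * s ^ 2 := by simp
    _ ≤ (d * s) ^ 2 := by
        rw [mul_pow]
        gcongr
        rcases Nat.eq_zero_or_pos d with h | h
        · simp [h]
        · have : (1 : ℝ) ≤ d := by exact_mod_cast h
          nlinarith

theorem edist_le_of_mem_rectangle {x : EuclideanSpace ℝ (Fin d)} {ℓ : Fin d → ℝ} {s : ℝ}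
    (hs : 0 ≤ s) (h : ∀ i, ℓ i ≤ s) {y z : EuclideanSpace ℝ (Fin d)} (hy : y ∈ rectangle x ℓ)
    (hz : z ∈ rectangle x ℓ) : edist y z ≤ ENNReal.ofReal (d * s) := by
  rw [edist_dist]
  refine ENNReal.ofReal_le_ofReal (dist_le_of_forall_abs_sub_le hs fun i => ?_)
  have h1 := hy i
  have h2 := hz i
  have h3 := h i
  rw [abs_le]
  constructor <;> linarith

theorem isCompact_rectangle (x : EuclideanSpace ℝ (Fin d)) (ℓ : Fin d → ℝ) :
    IsCompact (rectangle x ℓ) := by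
  refine Metric.isCompact_of_isClosed_isBounded (isClosed_rectangle x ℓ) ?_
  refine Metric.isBounded_iff.2 ⟨d * ∑ j, |ℓ j|, fun y hy z hz => ?_⟩
  have := edist_le_of_mem_rectangle (s := ∑ j, |ℓ j|) (by positivity) (fun i =>
    (le_abs_self _).trans (Finset.single_le_sum (f := fun j => |ℓ j|) (fun j _ => abs_nonneg _)
      (Finset.mem_univ i))) hy hz
  rw [edist_dist] at this
  exact (ENNReal.ofReal_le_ofReal_iff (by positivity)).1 this

theorem volume_rectangle (x : EuclideanSpace ℝ (Fin d)) {ℓ : Fin d → ℝ} (hℓ : ∀ i, 0 ≤ ℓ i) :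
    volume (rectangle x ℓ) = ENNReal.ofReal (∏ i, ℓ i) := by
  rw [rectangle_eq_preimage, (PiLp.volume_preserving_ofLp (Fin d)).measure_preimage
    measurableSet_Icc.nullMeasurableSet, Real.volume_Icc_pi, ENNReal.ofReal_prod_of_nonneg
    fun i _ => hℓ i]
  simp

/-- The affine map taking the unit cube to `rectangle x ℓ`. -/
noncomputable def rectangleMap (x : EuclideanSpace ℝ (Fin d)) (ℓ : Fin d → ℝ)
    (u : EuclideanSpace ℝ (Fin d)) : EuclideanSpace ℝ (Fin d) :=
  WithLp.toLp 2 fun i => x i + ℓ i * u i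

@[simp]
theorem rectangleMap_apply (x : EuclideanSpace ℝ (Fin d)) (ℓ : Fin d → ℝ)
    (u : EuclideanSpace ℝ (Fin d)) (i : Fin d) : rectangleMap x ℓ u i = x i + ℓ i * u i := rfl

theorem continuous_rectangleMap (x : EuclideanSpace ℝ (Fin d)) (ℓ : Fin d → ℝ) :
    Continuous (rectangleMap x ℓ) := by
  unfold rectangleMap
  fun_prop

theorem measurable_rectangleMap (x : EuclideanSpace ℝ (Fin d)) (ℓ : Fin d → ℝ) :
    Measurable (rectangleMap x ℓ) :=
  (continuous_rectangleMap x ℓ).measurable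

/-- The uniform probability measure on `rectangle x ℓ`. -/
noncomputable def uniformRectangle (x : EuclideanSpace ℝ (Fin d)) (ℓ : Fin d → ℝ) :
    Measure (EuclideanSpace ℝ (Fin d)) :=
  (volume.restrict (rectangle 0 fun _ => 1)).map (rectangleMap x ℓ)

theorem volume_unitCube : volume (rectangle (0 : EuclideanSpace ℝ (Fin d)) fun _ => 1) = 1 := by
  rw [volume_rectangle _ fun _ => zero_le_one]
  simp

instance (x : EuclideanSpace ℝ (Fin d)) (ℓ : Fin d → ℝ) :
    IsProbabilityMeasure (uniformRectangle x ℓ) := by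
  constructor
  rw [uniformRectangle, Measure.map_apply (measurable_rectangleMap x ℓ) MeasurableSet.univ]
  simp [volume_unitCube]

theorem map_rectangleMap_volume (x : EuclideanSpace ℝ (Fin d)) {ℓ : Fin d → ℝ}
    (hℓ : ∀ i, 0 < ℓ i) :
    ENNReal.ofReal (∏ i, ℓ i) • volume.map (rectangleMap x ℓ) = volume := by
  have hdet : (Matrix.diagonal ℓ).det ≠ 0 := by
    rw [Matrix.det_diagonal]
    exact (Finset.prod_pos fun i _ => hℓ i).ne'
  have h1 := Real.smul_map_diagonal_volume_pi hdet
  rw [Matrix.det_diagonal, abs_of_pos (Finset.prod_pos fun i _ => hℓ i)] at h1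
  have e : rectangleMap x ℓ = WithLp.toLp 2 ∘ (fun v => WithLp.ofLp x + v) ∘
      (Matrix.toLin' (Matrix.diagonal ℓ)) ∘ WithLp.ofLp := by
    ext u i
    simp [Matrix.mulVec_diagonal]
  have hm : Measurable (Matrix.toLin' (Matrix.diagonal ℓ)) :=
    (LinearMap.continuous_of_finiteDimensional _).measurable
  have a1 : Measurable (WithLp.ofLp : EuclideanSpace ℝ (Fin d) → Fin d → ℝ) :=
    (PiLp.volume_preserving_ofLp (Fin d)).measurable
  have a2 : Measurable (WithLp.toLp 2 : (Fin d → ℝ) → EuclideanSpace ℝ (Fin d)) :=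
    (PiLp.volume_preserving_toLp (Fin d)).measurable
  have a3 : Measurable fun v : Fin d → ℝ => WithLp.ofLp x + v := measurable_const_add _
  rw [e, ← Measure.map_map a2 (a3.comp (hm.comp a1)), ← Measure.map_map a3 (hm.comp a1),
    ← Measure.map_map hm a1, (PiLp.volume_preserving_ofLp (Fin d)).map_eq, ← Measure.map_smul,
    ← Measure.map_smul, h1, map_add_left_eq_self, (PiLp.volume_preserving_toLp (Fin d)).map_eq]

/-- As a pushforward, `uniformRectangle` stays a probability measure when a side vanishes; both
sides are then zero. Vanishing sides do occur, when all points lie on one side of a cut. -/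
theorem smul_uniformRectangle (x : EuclideanSpace ℝ (Fin d)) {ℓ : Fin d → ℝ} (hℓ : ∀ i, 0 ≤ ℓ i) :
    ENNReal.ofReal (∏ i, ℓ i) • uniformRectangle x ℓ = volume.restrict (rectangle x ℓ) := by
  by_cases h : ∀ i, 0 < ℓ i
  · have hpre : rectangleMap x ℓ ⁻¹' rectangle x ℓ = rectangle 0 fun _ => 1 := by
      ext u
      refine forall_congr' fun i => ?_
      have := h i
      simp only [rectangleMap_apply, le_add_iff_nonneg_right, mul_nonneg_iff_of_pos_left this,
        add_le_add_iff_left, PiLp.zero_apply, zero_add, mul_le_iff_le_one_right this]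
    rw [uniformRectangle, ← hpre, ← Measure.restrict_map (measurable_rectangleMap x ℓ)
      (measurableSet_rectangle x ℓ), ← Measure.restrict_smul, map_rectangleMap_volume x h]
  · push Not at h
    obtain ⟨i, hi⟩ := h
    have h0 : ∏ i, ℓ i = 0 := Finset.prod_eq_zero (Finset.mem_univ i) (le_antisymm hi (hℓ i))
    rw [Measure.restrict_eq_zero.2 (by rw [volume_rectangle x hℓ, h0, ENNReal.ofReal_zero]), h0,
      ENNReal.ofReal_zero, zero_smul]

/-- Moving the sides of a rectangle transports the uniform measure. -/
theorem transportCost_smul_uniformRectangle_le {p : ℝ} (hp : 0 ≤ p) (c : ℝ≥0∞)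
    {x y : EuclideanSpace ℝ (Fin d)} {ℓ k : Fin d → ℝ} {i : Fin d} {δ : ℝ}
    (hne : ∀ j, j ≠ i → x j = y j ∧ ℓ j = k j)
    (h0 : |x i - y i| ≤ δ) (h1 : |x i + ℓ i - (y i + k i)| ≤ δ) :
    transportCost p (c • uniformRectangle x ℓ) (c • uniformRectangle y k) ≤
      c * ENNReal.ofReal δ ^ p := by
  rw [uniformRectangle, uniformRectangle, ← Measure.map_smul, ← Measure.map_smul]
  refine (transportCost_map_le hp _ (measurable_rectangleMap x ℓ) (measurable_rectangleMap y k)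
    (δ := ENNReal.ofReal δ) ?_).trans (le_of_eq ?_)
  · refine Measure.ae_smul_measure ?_ c
    filter_upwards [ae_restrict_mem (measurableSet_rectangle _ _)] with u hu
    rw [edist_dist]
    refine ENNReal.ofReal_le_ofReal ?_
    rw [EuclideanSpace.dist_eq, Finset.sum_eq_single i, Real.sqrt_sq dist_nonneg, Real.dist_eq,
      rectangleMap_apply, rectangleMap_apply]
    · obtain ⟨u0, u1⟩ := hu i
      simp only [PiLp.zero_apply, zero_add] at u0 u1
      -- The displacement interpolates linearly between those of the two end faces.
      have e : x i + ℓ i * u i - (y i + k i * u i)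
          = (1 - u i) * (x i - y i) + u i * (x i + ℓ i - (y i + k i)) := by ring
      rw [e]
      calc _ ≤ (1 - u i) * |x i - y i| + u i * |x i + ℓ i - (y i + k i)| := by
            refine (abs_add_le _ _).trans (le_of_eq ?_)
            rw [abs_mul, abs_mul, abs_of_nonneg u0, abs_of_nonneg (by linarith : 0 ≤ 1 - u i)]
        _ ≤ (1 - u i) * δ + u i * δ := by gcongr
        _ = δ := by ring
    · intro j _ hj
      simp [rectangleMap_apply, (hne j hj).1, (hne j hj).2]
    · simp
  · rw [Measure.smul_apply, Measure.restrict_apply_univ, volume_unitCube, smul_eq_mul, mul_one,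
      mul_comm]

end Rectangles

/-! ### Cutting a rectangle in two -/

section Splitting

variable {d : ℕ}

/-- The face at height `a` separating the two parts of `rectangle x ℓ` cut across direction `i`. -/
def splitFace (x : EuclideanSpace ℝ (Fin d)) (ℓ : Fin d → ℝ) (i : Fin d) (a : ℝ) :
    Set (EuclideanSpace ℝ (Fin d)) :=
  rectangle (x + EuclideanSpace.single i a) (Function.update ℓ i 0)

variable {x : EuclideanSpace ℝ (Fin d)} {ℓ : Fin d → ℝ} {i : Fin d} {a b : ℝ}

theorem update_nonneg (hℓ : ∀ j, 0 ≤ ℓ j) (ha : 0 ≤ a) (j : Fin d) :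
    0 ≤ Function.update ℓ i a j := by
  rcases eq_or_ne j i with rfl | h
  · simpa
  · simpa [h] using hℓ j

theorem update_pos (hℓ : ∀ j, 0 < ℓ j) (ha : 0 < a) (j : Fin d) :
    0 < Function.update ℓ i a j := by
  rcases eq_or_ne j i with rfl | h
  · simpa
  · simpa [h] using hℓ j

theorem prod_update_mul (i : Fin d) (ℓ : Fin d → ℝ) (t : ℝ) :
    ∏ j, Function.update ℓ i (t * ℓ i) j = t * ∏ j, ℓ j := by
  rw [Finset.prod_update_of_mem (Finset.mem_univ i), mul_assoc, Finset.sdiff_singleton_eq_erase,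
    Finset.mul_prod_erase _ _ (Finset.mem_univ i)]

theorem volume_splitFace (x : EuclideanSpace ℝ (Fin d)) (hℓ : ∀ j, 0 ≤ ℓ j) :
    volume (splitFace x ℓ i a) = 0 := by
  rw [splitFace, volume_rectangle _ (update_nonneg hℓ le_rfl),
    Finset.prod_eq_zero (Finset.mem_univ i) (by simp), ENNReal.ofReal_zero]

theorem rectangle_split (ha : 0 ≤ a) (hb : 0 ≤ b) (hab : a + b = ℓ i) :
    rectangle x ℓ = rectangle x (Function.update ℓ i a) ∪
      rectangle (x + EuclideanSpace.single i a) (Function.update ℓ i b) := by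
  ext y
  constructor
  · intro h
    rcases le_total (y i) (x i + a) with h1 | h1
    · refine Or.inl fun j => ?_
      rcases eq_or_ne j i with rfl | hj
      · simpa using ⟨(h j).1, h1⟩
      · simpa [hj] using h j
    · refine Or.inr fun j => ?_
      rcases eq_or_ne j i with rfl | hj
      · have := (h j).2
        simp only [PiLp.add_apply, PiLp.single_apply, if_true, Function.update_self]
        constructor <;> linarith
      · simpa [hj] using h j
  · rintro (h | h) j
    · have := h j
      rcases eq_or_ne j i with rfl | hj
      · simp only [Function.update_self] at this
        constructor <;> linarith
      · simpa [hj] using this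
    · have := h j
      rcases eq_or_ne j i with rfl | hj
      · simp only [PiLp.add_apply, PiLp.single_apply, if_true,
          Function.update_self] at this
        constructor <;> linarith
      · simpa [hj] using this

theorem rectangle_inter_subset_splitFace :
    rectangle x (Function.update ℓ i a) ∩
      rectangle (x + EuclideanSpace.single i a) (Function.update ℓ i b) ⊆ splitFace x ℓ i a := by
  rintro y ⟨h1, h2⟩ j
  have h1 := h1 j
  have h2 := h2 j
  rcases eq_or_ne j i with rfl | hj
  · simp only [PiLp.add_apply, PiLp.single_apply, if_true,
      Function.update_self] at h1 h2 ⊢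
    constructor <;> linarith
  · simpa [hj] using h2

theorem restrict_rectangle_split (m : Measure (EuclideanSpace ℝ (Fin d))) (ha : 0 ≤ a)
    (hb : 0 ≤ b) (hab : a + b = ℓ i) (hm : m (splitFace x ℓ i a) = 0) :
    m.restrict (rectangle x ℓ) = m.restrict (rectangle x (Function.update ℓ i a)) +
      m.restrict (rectangle (x + EuclideanSpace.single i a) (Function.update ℓ i b)) := by
  rw [rectangle_split ha hb hab, Measure.restrict_union₀ _ (measurableSet_rectangle _ _).nullMeasurableSet]
  exact measure_mono_null rectangle_inter_subset_splitFace hm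

/-- After multiplication by the volume, this is the additivity of Lebesgue measure across a null
face. -/
theorem uniformRectangle_split (x : EuclideanSpace ℝ (Fin d)) (i : Fin d) (hℓ : ∀ j, 0 < ℓ j)
    {t : ℝ} (h0 : 0 ≤ t) (h1 : t ≤ 1) :
    uniformRectangle x ℓ =
      ENNReal.ofReal t • uniformRectangle x (Function.update ℓ i (t * ℓ i)) +
      ENNReal.ofReal (1 - t) • uniformRectangle (x + EuclideanSpace.single i (t * ℓ i))
        (Function.update ℓ i ((1 - t) * ℓ i)) := by
  have hV : 0 < ∏ j, ℓ j := Finset.prod_pos fun j _ => hℓ j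
  have hi := (hℓ i).le
  have hℓ' := fun j => (hℓ j).le
  have h1' : 0 ≤ 1 - t := sub_nonneg.2 h1
  have key : ENNReal.ofReal (∏ j, ℓ j) • uniformRectangle x ℓ = ENNReal.ofReal (∏ j, ℓ j) •
      (ENNReal.ofReal t • uniformRectangle x (Function.update ℓ i (t * ℓ i)) +
      ENNReal.ofReal (1 - t) • uniformRectangle (x + EuclideanSpace.single i (t * ℓ i))
        (Function.update ℓ i ((1 - t) * ℓ i))) := by
    rw [smul_uniformRectangle x hℓ', restrict_rectangle_split (i := i) volume (a := t * ℓ i)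
      (b := (1 - t) * ℓ i) (by positivity) (by positivity) (by ring) (volume_splitFace x hℓ'),
      ← smul_uniformRectangle x (update_nonneg hℓ' (by positivity)),
      ← smul_uniformRectangle _ (update_nonneg hℓ' (by positivity)),
      prod_update_mul, prod_update_mul, smul_add, smul_smul, smul_smul,
      ENNReal.ofReal_mul h0, ENNReal.ofReal_mul h1', mul_comm, mul_comm (ENNReal.ofReal (1 - t))]
  have := congrArg (fun m => (ENNReal.ofReal (∏ j, ℓ j))⁻¹ • m) key
  simpa only [smul_smul, ENNReal.inv_mul_cancel (ENNReal.ofReal_pos.2 hV).ne'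
    ENNReal.ofReal_ne_top, one_smul] using this

/-- The uniform measure on the whole rectangle gives the masses `n₁` and `n₂` to the two sides of
the hyperplane at fraction `n₁ / (n₁ + n₂)`. Stretching each part affinely onto the matching side
keeps the outer faces fixed, so no point moves more than the interface. -/
theorem transportCost_split_le {p : ℝ} (hp : 0 ≤ p) (x : EuclideanSpace ℝ (Fin d))
    (hℓ : ∀ j, 0 < ℓ j) (hab : a + b = ℓ i)
    {n₁ n₂ : ℝ} (h₁ : 0 ≤ n₁) (h₂ : 0 ≤ n₂) (h : 0 < n₁ + n₂) :
    transportCost p (ENNReal.ofReal n₁ • uniformRectangle x (Function.update ℓ i a) +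
        ENNReal.ofReal n₂ • uniformRectangle (x + EuclideanSpace.single i a)
          (Function.update ℓ i b))
      (ENNReal.ofReal (n₁ + n₂) • uniformRectangle x ℓ) ≤
      ENNReal.ofReal (n₁ + n₂) * ENNReal.ofReal |a - n₁ / (n₁ + n₂) * ℓ i| ^ p := by
  set t := n₁ / (n₁ + n₂) with ht
  have t0 : 0 ≤ t := by positivity
  have t1 : 1 - t = n₂ / (n₁ + n₂) := by rw [ht]; field_simp; ring
  have t1' : 0 ≤ 1 - t := by rw [t1]; positivity
  have e1 : n₁ = (n₁ + n₂) * t := by rw [ht]; field_simp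
  have e2 : n₂ = (n₁ + n₂) * (1 - t) := by rw [t1]; field_simp
  rw [uniformRectangle_split x i hℓ t0 (sub_nonneg.1 t1'), smul_add, smul_smul, smul_smul,
    ← ENNReal.ofReal_mul h.le, ← ENNReal.ofReal_mul h.le, ← e1, ← e2]
  refine (transportCost_add_le _ _ _ _ _).trans ?_
  rw [ENNReal.ofReal_add h₁ h₂, add_mul]
  gcongr
  · refine transportCost_smul_uniformRectangle_le (i := i) hp _ (fun j hj => by simp [hj]) ?_ ?_
    · simp
    · simp
  · refine transportCost_smul_uniformRectangle_le (i := i) hp _ (fun j hj => by simp [hj]) ?_ ?_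
    · simp
    · simp only [PiLp.add_apply, PiLp.single_apply, if_true, Function.update_self]
      have : x i + a + b - (x i + t * ℓ i + (1 - t) * ℓ i) = 0 := by
        rw [add_assoc, hab]; ring
      rw [this]
      simp

/-- The cost of matching `m` on a rectangle to the uniform measure of the same mass. -/
noncomputable def rectangleCost (p : ℝ) (m : Measure (EuclideanSpace ℝ (Fin d)))
    (x : EuclideanSpace ℝ (Fin d)) (ℓ : Fin d → ℝ) : ℝ≥0∞ :=
  transportCost p (m.restrict (rectangle x ℓ)) (m (rectangle x ℓ) • uniformRectangle x ℓ)

theorem refCost_rectangle (p : ℝ) (m : Measure (EuclideanSpace ℝ (Fin d)))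
    (x : EuclideanSpace ℝ (Fin d)) (hℓ : ∀ j, 0 < ℓ j) :
    refCost p (rectangle x ℓ) m = ENNReal.ofReal (∏ j, ℓ j)⁻¹ * rectangleCost p m x ℓ := by
  have hV : 0 < ∏ j, ℓ j := Finset.prod_pos fun j _ => hℓ j
  rw [refCost, transportCostOn, rectangleCost, Measure.restrict_smul,
    ← smul_uniformRectangle x fun j => (hℓ j).le, smul_smul,
    volume_rectangle x fun j => (hℓ j).le, ENNReal.div_mul_cancel
    (ENNReal.ofReal_pos.2 hV).ne' ENNReal.ofReal_ne_top, ENNReal.ofReal_inv_of_pos hV]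

theorem rectangleCost_le {p : ℝ} (hp : 0 ≤ p) (m : Measure (EuclideanSpace ℝ (Fin d)))
    [IsLocallyFiniteMeasure m] (x : EuclideanSpace ℝ (Fin d)) (hℓ : ∀ j, 0 < ℓ j) {s : ℝ}
    (hs : ∀ j, ℓ j ≤ s) (hs0 : 0 ≤ s) :
    rectangleCost p m x ℓ ≤ ENNReal.ofReal (d * s) ^ p * m (rectangle x ℓ) := by
  have hfin : m (rectangle x ℓ) ≠ ∞ := (isCompact_rectangle x ℓ).measure_lt_top.ne
  have : IsFiniteMeasure (m.restrict (rectangle x ℓ)) := ⟨by simpa using hfin.lt_top⟩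
  have : IsFiniteMeasure (m (rectangle x ℓ) • uniformRectangle x ℓ) :=
    ⟨by simpa using hfin.lt_top⟩
  have hV : 0 < ∏ j, ℓ j := Finset.prod_pos fun j _ => hℓ j
  have hu : ∀ᵐ y ∂uniformRectangle x ℓ, y ∈ rectangle x ℓ := by
    have h : uniformRectangle x ℓ =
        (ENNReal.ofReal (∏ j, ℓ j))⁻¹ • volume.restrict (rectangle x ℓ) := by
      rw [← smul_uniformRectangle x fun j => (hℓ j).le, smul_smul,
        ENNReal.inv_mul_cancel (ENNReal.ofReal_pos.2 hV).ne' ENNReal.ofReal_ne_top, one_smul]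
    rw [h]
    exact Measure.ae_smul_measure (ae_restrict_mem (measurableSet_rectangle _ _)) _
  have := transportCost_le_of_edist_le hp (μ := m.restrict (rectangle x ℓ))
    (ν := m (rectangle x ℓ) • uniformRectangle x ℓ) (by simp)
    (ae_restrict_mem (measurableSet_rectangle _ _)) (Measure.ae_smul_measure hu _)
    (δ := ENNReal.ofReal (d * s))
    (fun y hy z hz => edist_le_of_mem_rectangle hs0 hs hy hz)
  rwa [Measure.restrict_apply_univ] at this

/-- One step of the multiscale decomposition. -/
theorem rectangleCost_split_le {p : ℝ} (hp : 1 ≤ p) (m : Measure (EuclideanSpace ℝ (Fin d)))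
    [IsLocallyFiniteMeasure m] (x : EuclideanSpace ℝ (Fin d))
    (hℓ : ∀ j, 0 < ℓ j) (ha : 0 ≤ a) (hb : 0 ≤ b) (hab : a + b = ℓ i)
    (hm : m (splitFace x ℓ i a) = 0) :
    rectangleCost p m x ℓ ^ (1 / p) ≤
      (rectangleCost p m x (Function.update ℓ i a) +
        rectangleCost p m (x + EuclideanSpace.single i a) (Function.update ℓ i b)) ^ (1 / p) +
      (m (rectangle x ℓ) * ENNReal.ofReal |a - (m (rectangle x (Function.update ℓ i a))).toReal /
        (m (rectangle x ℓ)).toReal * ℓ i| ^ p) ^ (1 / p) := by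
  have hp0 : 0 ≤ p := by linarith
  have hsplit := restrict_rectangle_split m ha hb hab hm
  set R := rectangle x ℓ
  set R₁ := rectangle x (Function.update ℓ i a)
  set R₂ := rectangle (x + EuclideanSpace.single i a) (Function.update ℓ i b)
  have f : m R ≠ ∞ := (isCompact_rectangle _ _).measure_lt_top.ne
  have f₁ : m R₁ ≠ ∞ := (isCompact_rectangle _ _).measure_lt_top.ne
  have f₂ : m R₂ ≠ ∞ := (isCompact_rectangle _ _).measure_lt_top.ne
  have hN : m R = m R₁ + m R₂ := by
    have := congrArg (fun η => η Set.univ) hsplit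
    simpa using this
  have hcost : rectangleCost p m x ℓ = transportCost p (m.restrict R) (m R • uniformRectangle x ℓ) := rfl
  have : IsFiniteMeasure (m.restrict R) := ⟨by simpa using f.lt_top⟩
  -- Without points the left side vanishes; otherwise the fraction of mass in the first part is
  -- meaningful.
  by_cases h0 : m R = 0
  · have : m.restrict R = 0 := Measure.restrict_eq_zero.2 h0
    rw [hcost, this, h0]
    simp [show 0 < p by linarith]
  have : IsFiniteMeasure (m.restrict R₁) := ⟨by simpa using f₁.lt_top⟩
  have : IsFiniteMeasure (m.restrict R₂) := ⟨by simpa using f₂.lt_top⟩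
  have : IsFiniteMeasure (m R₁ • uniformRectangle x (Function.update ℓ i a)) :=
    ⟨by simpa using f₁.lt_top⟩
  have : IsFiniteMeasure (m R₂ • uniformRectangle (x + EuclideanSpace.single i a)
    (Function.update ℓ i b)) := ⟨by simpa using f₂.lt_top⟩
  have hNr : (m R).toReal = (m R₁).toReal + (m R₂).toReal := by
    rw [hN, ENNReal.toReal_add f₁ f₂]
  have hpos : 0 < (m R₁).toReal + (m R₂).toReal := hNr ▸ ENNReal.toReal_pos h0 f
  have e1 := ENNReal.ofReal_toReal f₁
  have e2 := ENNReal.ofReal_toReal f₂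
  have e : ENNReal.ofReal ((m R₁).toReal + (m R₂).toReal) = m R := by
    rw [← hNr, ENNReal.ofReal_toReal f]
  have hS := transportCost_split_le hp0 x hℓ hab (ENNReal.toReal_nonneg (a := m R₁))
    (ENNReal.toReal_nonneg (a := m R₂)) hpos
  rw [e, e1, e2, ← hNr] at hS
  -- The intermediate measure is uniform on each part, with the mass that `m` gives to that part.
  have hT := transportDist_triangle hp (m.restrict R)
    (m R₁ • uniformRectangle x (Function.update ℓ i a) +
      m R₂ • uniformRectangle (x + EuclideanSpace.single i a) (Function.update ℓ i b))
    (m R • uniformRectangle x ℓ)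
  refine hT.trans (add_le_add (ENNReal.rpow_le_rpow ?_ (by positivity))
    (ENNReal.rpow_le_rpow hS (by positivity)))
  rw [hsplit]
  exact transportCost_add_le _ _ _ _ _

end Splitting

/-- With D the sum of the two deviations, |θn - n₁| is at most both D and n. If n ≥ V/2, use the
first bound and n^(1-p) ≤ (V/2)^(1-p). If n ≤ V/2, the deviation of n alone forces V ≤ 2D, and the
second bound suffices. Thus negative powers of the random count n never enter the expectation. -/
theorem displacement_bound {p n n₁ θ V ℓ : ℝ} (hp : 1 ≤ p) (hn : 0 < n) (h0 : 0 ≤ n₁)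
    (h1 : n₁ ≤ n) (hθ : 0 ≤ θ) (hθ' : θ ≤ 1) (hV : 0 < V) (hℓ : 0 ≤ ℓ) :
    n * |θ * ℓ - n₁ / n * ℓ| ^ p ≤
      2 ^ p * ℓ ^ p * V ^ (1 - p) * (|n₁ - θ * V| + |n - V|) ^ p := by
  set D := |n₁ - θ * V| + |n - V| with hD
  have hp0 : 0 ≤ p := by linarith
  have hD0 : 0 ≤ D := by positivity
  have e : |θ * ℓ - n₁ / n * ℓ| = ℓ * (|θ * n - n₁| / n) := by
    have : θ * ℓ - n₁ / n * ℓ = ℓ * ((θ * n - n₁) / n) := by field_simp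
    rw [this, abs_mul, abs_div, abs_of_nonneg hℓ, abs_of_pos hn]
  have hE1 : |θ * n - n₁| ≤ D := by
    have : θ * n - n₁ = -(n₁ - θ * V) + θ * (n - V) := by ring
    rw [this]
    refine (abs_add_le _ _).trans ?_
    rw [abs_neg, abs_mul, abs_of_nonneg hθ]
    have := abs_nonneg (n - V)
    rw [hD]
    nlinarith
  have hE2 : |θ * n - n₁| ≤ n := by
    rw [abs_le]
    constructor <;> nlinarith
  have key : n * (|θ * n - n₁| / n) ^ p ≤ 2 ^ p * V ^ (1 - p) * D ^ p := by
    rcases le_total (V / 2) n with h | h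
    · calc n * (|θ * n - n₁| / n) ^ p ≤ n * (D / n) ^ p := by gcongr
        _ = n ^ (1 - p) * D ^ p := by
            rw [Real.div_rpow hD0 hn.le, Real.rpow_sub hn, Real.rpow_one]; ring
        _ ≤ (V / 2) ^ (1 - p) * D ^ p := by
            gcongr ?_ * _
            exact Real.rpow_le_rpow_of_nonpos (by positivity) h (by linarith)
        _ = 2 ^ (p - 1) * V ^ (1 - p) * D ^ p := by
            rw [Real.div_rpow hV.le zero_le_two, show p - 1 = -(1 - p) by ring,
              Real.rpow_neg zero_le_two]; ring
        _ ≤ _ := by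
            gcongr
            · norm_num
            · linarith
    · have hDV : V ≤ 2 * D := by
        have := neg_le_abs (n - V)
        have := abs_nonneg (n₁ - θ * V)
        linarith
      calc n * (|θ * n - n₁| / n) ^ p ≤ n * 1 ^ p := by
            gcongr
            exact div_le_one_of_le₀ hE2 hn.le
        _ ≤ V := by rw [Real.one_rpow]; linarith
        _ = V ^ (1 - p) * V ^ p := by rw [← Real.rpow_add hV]; simp
        _ ≤ V ^ (1 - p) * (2 * D) ^ p := by gcongr
        _ = _ := by rw [Real.mul_rpow zero_le_two hD0]; ring
  rw [e, Real.mul_rpow hℓ (by positivity)]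
  calc n * (ℓ ^ p * (|θ * n - n₁| / n) ^ p) = ℓ ^ p * (n * (|θ * n - n₁| / n) ^ p) := by ring
    _ ≤ ℓ ^ p * (2 ^ p * V ^ (1 - p) * D ^ p) := by gcongr
    _ = _ := by ring

/-! ### Approximation of the cost by finitely many counts -/

section Discretization

theorem exists_simpleFunc_edist_le {E : Type*} [MetricSpace E] [MeasurableSpace E]
    [OpensMeasurableSpace E] [Nonempty E] {A : Set E} (hA : IsCompact A) {ε : ℝ≥0∞} (hε : ε ≠ 0) :
    ∃ T : SimpleFunc E E, ∀ x ∈ A, edist (T x) x ≤ ε := by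
  obtain ⟨t, ht, hAt⟩ := EMetric.totallyBounded_iff.1 hA.totallyBounded ε (pos_iff_ne_zero.2 hε)
  obtain ⟨e⟩ := ‹Nonempty E›
  -- `SimpleFunc.nearestPt` also considers the index equal to the length, where the default `e`
  -- appears; an additional candidate cannot increase the distance to the nearest one.
  set s : ℕ → E := fun n => ht.toFinset.toList.getD n e
  refine ⟨SimpleFunc.nearestPt s ht.toFinset.toList.length, fun x hx => ?_⟩
  obtain ⟨y, hy, hxy⟩ := Set.mem_iUnion₂.1 (hAt hx)
  have hy' : y ∈ ht.toFinset.toList := by simpa using hy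
  obtain ⟨k, hk, rfl⟩ := List.mem_iff_getElem.1 hy'
  refine (SimpleFunc.edist_nearestPt_le s x hk.le).trans ?_
  simp only [s]
  rw [List.getD_eq_getElem _ _ hk, edist_comm]
  exact (Metric.mem_eball.1 hxy).le

theorem map_simpleFunc_eq_sum {E F : Type*} [MeasurableSpace E] [MeasurableSpace F]
    (η : Measure E) (T : SimpleFunc E F) :
    η.map T = ∑ c ∈ T.range, η (T ⁻¹' {c}) • Measure.dirac c := by
  ext A hA
  have h : η (T ⁻¹' A) = ∫⁻ x, (A.indicator 1 (T x) : ℝ≥0∞) ∂η := by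
    rw [← lintegral_indicator_one (T.measurable hA)]
    rfl
  have h2 := SimpleFunc.lintegral_eq_lintegral (T.map (A.indicator (1 : F → ℝ≥0∞))) η
  rw [SimpleFunc.map_lintegral] at h2
  rw [Measure.map_apply T.measurable hA, h, Measure.finsetSum_apply]
  refine Eq.trans h2 (Finset.sum_congr rfl fun c _ => ?_)
  rw [Measure.smul_apply, Measure.dirac_apply' c hA, smul_eq_mul, mul_comm]

variable {d : ℕ}

/-- Up to a small error, the cost on a rectangle depends only on finitely many counts. -/
theorem exists_approx_by_counts {p : ℝ} (hp : 1 ≤ p) (x : EuclideanSpace ℝ (Fin d))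
    (ℓ : Fin d → ℝ) {ε : ℝ≥0∞} (hε : ε ≠ 0) :
    ∃ (k : ℕ) (A : Fin k → Set (EuclideanSpace ℝ (Fin d))) (G : (Fin k → ℕ) → ℝ≥0∞),
      (∀ j, MeasurableSet (A j)) ∧ Pairwise (Function.onFun Disjoint A) ∧
      (∀ j, A j ⊆ rectangle x ℓ) ∧
      ∀ (m : Measure (EuclideanSpace ℝ (Fin d))) [IsLocallyFiniteMeasure m] (v : Fin k → ℕ),
        (∀ j, m (A j) = v j) →
        rectangleCost p m x ℓ ^ (1 / p) ≤ G v + ε * m (rectangle x ℓ) ^ (1 / p) ∧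
        G v ≤ rectangleCost p m x ℓ ^ (1 / p) + ε * m (rectangle x ℓ) ^ (1 / p) := by
  have hp0 : 0 < p := by linarith
  obtain ⟨T, hT⟩ := exists_simpleFunc_edist_le (isCompact_rectangle x ℓ) hε
  set c : Fin T.range.card → EuclideanSpace ℝ (Fin d) := fun j => T.range.equivFin.symm j with hc
  have hcinj : Function.Injective c :=
    Subtype.val_injective.comp (Equiv.injective _)
  -- `G v` is the distance to uniform after every point has been moved to the value of `T` on its
  -- cell; this moved configuration is determined by the cell counts.
  refine ⟨T.range.card, fun j => T ⁻¹' {c j} ∩ rectangle x ℓ, fun v =>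
    transportDist p (∑ j, (v j : ℝ≥0∞) • Measure.dirac (c j))
      ((∑ j, (v j : ℝ≥0∞)) • uniformRectangle x ℓ),
    fun j => (T.measurableSet_preimage _).inter (measurableSet_rectangle x ℓ), ?_,
    fun j => Set.inter_subset_right, fun m _ v hv => ?_⟩
  · intro i j hij
    refine Set.disjoint_left.2 fun y hy hy' => hij (hcinj ?_)
    exact hy.1.symm.trans hy'.1
  have f : m (rectangle x ℓ) ≠ ∞ := (isCompact_rectangle x ℓ).measure_lt_top.ne
  set η := m.restrict (rectangle x ℓ) with hη
  have : IsFiniteMeasure η := ⟨by simpa [hη] using f.lt_top⟩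
  have hmap : η.map T = ∑ j, (v j : ℝ≥0∞) • Measure.dirac (c j) := by
    rw [map_simpleFunc_eq_sum η T, ← Finset.sum_coe_sort,
      ← Equiv.sum_comp T.range.equivFin.symm]
    refine Finset.sum_congr rfl fun j _ => ?_
    rw [← hv j, hη, Measure.restrict_apply (T.measurableSet_preimage _)]
  have hmass : ∑ j, (v j : ℝ≥0∞) = m (rectangle x ℓ) := by
    have h := congrArg (fun m => m Set.univ) hmap
    simp only [Measure.map_apply T.measurable MeasurableSet.univ, Set.preimage_univ,
      Measure.finsetSum_apply, Measure.smul_apply, measure_univ, smul_eq_mul, mul_one] at h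
    rw [← h, hη, Measure.restrict_apply_univ]
  have hη' : ∀ᵐ y ∂η, edist (T y) y ≤ ε := by
    filter_upwards [ae_restrict_mem (measurableSet_rectangle x ℓ)] with y hy using hT y hy
  have hroot : ∀ s : ℝ≥0∞, (ε ^ p * s) ^ (1 / p) = ε * s ^ (1 / p) := fun s => by
    rw [ENNReal.mul_rpow_of_nonneg _ _ (by positivity), ← ENNReal.rpow_mul,
      mul_one_div_cancel hp0.ne', ENNReal.rpow_one]
  have hu : η Set.univ = m (rectangle x ℓ) := by rw [hη, Measure.restrict_apply_univ]
  have d1 : transportDist p η (η.map T) ≤ ε * m (rectangle x ℓ) ^ (1 / p) := by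
    rw [← hroot, ← hu]
    refine ENNReal.rpow_le_rpow ?_ (by positivity)
    simpa using transportCost_map_le hp0.le η measurable_id T.measurable
      (hη'.mono fun y hy => (edist_comm _ _).trans_le hy)
  have d2 : transportDist p (η.map T) η ≤ ε * m (rectangle x ℓ) ^ (1 / p) := by
    rw [← hroot, ← hu]
    refine ENNReal.rpow_le_rpow ?_ (by positivity)
    simpa using transportCost_map_le hp0.le η T.measurable measurable_id hη'
  beta_reduce
  rw [← hmap, hmass]
  constructor
  · rw [add_comm]
    exact (transportDist_triangle hp η (η.map T) _).trans (add_le_add d1 le_rfl)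
  · rw [add_comm]
    exact (transportDist_triangle hp (η.map T) η _).trans (add_le_add d2 le_rfl)

end Discretization

/-! ### Moments of the Poisson law -/

section PoissonMoments

theorem lintegral_poissonMeasure (r : ℝ≥0) (f : ℕ → ℝ≥0∞) :
    ∫⁻ n, f n ∂poissonMeasure r =
      ∑' n : ℕ, f n * ENNReal.ofReal (Real.exp (-r) * r ^ n / n.factorial) := by
  rw [lintegral_countable']
  simp [poissonMeasure_singleton]

theorem lintegral_natCast_poissonMeasure (r : ℝ≥0) :
    ∫⁻ n, (n : ℝ≥0∞) ∂poissonMeasure r = r := by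
  have h1 : ∑' n : ℕ, ENNReal.ofReal (Real.exp (-r) * r ^ n / n.factorial) = 1 := by
    have := lintegral_poissonMeasure r fun _ => 1
    simpa using this.symm
  rw [lintegral_poissonMeasure, tsum_eq_zero_add' ENNReal.summable]
  have h2 : ∀ n : ℕ, ((n + 1 : ℕ) : ℝ≥0∞) *
      ENNReal.ofReal (Real.exp (-r) * r ^ (n + 1) / (n + 1).factorial) =
      r * ENNReal.ofReal (Real.exp (-r) * r ^ n / n.factorial) := by
    intro n
    rw [← ENNReal.ofReal_natCast, ← ENNReal.ofReal_coe_nnreal (p := r),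
      ← ENNReal.ofReal_mul (by positivity), ← ENNReal.ofReal_mul (by positivity)]
    congr 1
    rw [Nat.factorial_succ]
    push_cast
    field_simp
    ring
  simp only [h2, ENNReal.tsum_mul_left, h1]
  simp

theorem lintegral_exp_poissonMeasure (r : ℝ≥0) (t : ℝ) :
    ∫⁻ n, ENNReal.ofReal (Real.exp (t * (n - r))) ∂poissonMeasure r =
      ENNReal.ofReal (Real.exp (r * (Real.exp t - 1 - t))) := by
  rw [lintegral_poissonMeasure]
  have h : HasSum (fun n : ℕ => Real.exp (t * (n - r)) * (Real.exp (-r) * r ^ n / n.factorial))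
      (Real.exp (r * (Real.exp t - 1 - t))) := by
    have h0 := (NormedSpace.expSeries_div_hasSum_exp (r * Real.exp t)).mul_left
      (Real.exp (-r - t * r))
    rw [← Real.exp_eq_exp_ℝ, ← Real.exp_add] at h0
    have e1 : Real.exp (-r - t * r + r * Real.exp t) = Real.exp (r * (Real.exp t - 1 - t)) := by
      ring_nf
    rw [e1] at h0
    refine h0.congr_fun fun n => ?_
    have e2 : Real.exp (t * (n - r)) * Real.exp (-r) =
        Real.exp (-r - t * r) * Real.exp t ^ n := by
      rw [← Real.exp_nat_mul, ← Real.exp_add, ← Real.exp_add]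
      ring_nf
    rw [mul_pow, ← mul_div_assoc, ← mul_div_assoc, ← mul_assoc, e2]
    ring
  rw [← h.tsum_eq, ENNReal.ofReal_tsum_of_nonneg (fun n => by positivity) h.summable]
  refine tsum_congr fun n => ?_
  rw [ENNReal.ofReal_mul (by positivity)]

theorem exists_abs_rpow_le_exp {p : ℝ} (hp : 0 ≤ p) :
    ∃ C : ℝ, 0 < C ∧ ∀ y : ℝ, |y| ^ p ≤ C * (Real.exp y + Real.exp (-y)) := by
  set n := ⌈p⌉₊ with hn
  refine ⟨1 + n.factorial, by positivity, fun y => ?_⟩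
  have h1 : |y| ^ p ≤ 1 + |y| ^ n := by
    rcases le_total |y| 1 with h | h
    · exact (Real.rpow_le_one (abs_nonneg y) h hp).trans (by linarith [pow_nonneg (abs_nonneg y) n])
    · have := Real.rpow_le_rpow_of_exponent_le h (Nat.le_ceil p)
      rw [Real.rpow_natCast] at this
      linarith
  have h2 : |y| ^ n ≤ n.factorial * Real.exp |y| := by
    have := Real.pow_div_factorial_le_exp |y| (abs_nonneg y) n
    rwa [div_le_iff₀ (by positivity), mul_comm] at this
  have h3 : Real.exp |y| ≤ Real.exp y + Real.exp (-y) := by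
    rcases abs_cases y with ⟨h, _⟩ | ⟨h, _⟩ <;> rw [h] <;>
      linarith [Real.exp_pos y, Real.exp_pos (-y)]
  have h4 : 1 ≤ Real.exp |y| := Real.one_le_exp (abs_nonneg y)
  calc |y| ^ p ≤ (1 + n.factorial) * Real.exp |y| := by linarith
    _ ≤ _ := by gcongr

/-- Central moments of the Poisson law. -/
theorem exists_lintegral_poissonMeasure_abs_sub_rpow_le {p : ℝ} (hp : 0 ≤ p) :
    ∃ C : ℝ, 0 < C ∧ ∀ r : ℝ≥0, 1 ≤ r →
      ∫⁻ n : ℕ, ENNReal.ofReal (|(n : ℝ) - r| ^ p) ∂poissonMeasure r ≤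
        ENNReal.ofReal (C * (r : ℝ) ^ (p / 2)) := by
  obtain ⟨K, hK, hexp⟩ := exists_abs_rpow_le_exp hp
  refine ⟨K * (2 * Real.exp 1), by positivity, fun r hr => ?_⟩
  have hr' : (1 : ℝ) ≤ r := by exact_mod_cast hr
  set s := Real.sqrt r with hs
  have hs1 : 1 ≤ s := Real.one_le_sqrt.2 hr'
  have hss : s ^ 2 = r := Real.sq_sqrt (by positivity)
  -- Exponential moments are taken at ±1/√r, the scale of the standard deviation: |t| ≤ 1 because r
  -- ≥ 1, hence r(e^t - 1 - t) ≤ rt² = 1.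
  have hmgf : ∀ t : ℝ, |t| = s⁻¹ → Real.exp (r * (Real.exp t - 1 - t)) ≤ Real.exp 1 := by
    intro t ht
    refine Real.exp_le_exp.2 ?_
    have h1 := (abs_le.1 (Real.abs_exp_sub_one_sub_id_le (x := t)
      (by rw [ht]; exact inv_le_one_of_one_le₀ hs1))).2
    have h2 : t ^ 2 = (r : ℝ)⁻¹ := by rw [← sq_abs, ht, inv_pow, hss]
    calc (r : ℝ) * (Real.exp t - 1 - t) ≤ r * t ^ 2 := by gcongr
      _ = 1 := by rw [h2, mul_inv_cancel₀ (by positivity)]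
  have hpt : ∀ n : ℕ, ENNReal.ofReal (|(n : ℝ) - r| ^ p) ≤
      ENNReal.ofReal (s ^ p * K) * (ENNReal.ofReal (Real.exp (s⁻¹ * (n - r))) +
        ENNReal.ofReal (Real.exp (-s⁻¹ * (n - r)))) := by
    intro n
    rw [← ENNReal.ofReal_add (by positivity) (by positivity), ← ENNReal.ofReal_mul (by positivity)]
    refine ENNReal.ofReal_le_ofReal ?_
    have h := hexp (s⁻¹ * (n - r))
    have e : |(n : ℝ) - r| ^ p = s ^ p * |s⁻¹ * ((n : ℝ) - r)| ^ p := by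
      rw [← Real.mul_rpow (by positivity) (by positivity), abs_mul, abs_inv,
        abs_of_pos (by positivity : 0 < s), mul_inv_cancel_left₀ (by positivity)]
    rw [e, mul_assoc, neg_mul]
    gcongr
  calc _ ≤ _ := lintegral_mono hpt
    _ = ENNReal.ofReal (s ^ p * K) * (ENNReal.ofReal (Real.exp (r * (Real.exp s⁻¹ - 1 - s⁻¹))) +
        ENNReal.ofReal (Real.exp (r * (Real.exp (-s⁻¹) - 1 - (-s⁻¹))))) := by
      rw [lintegral_const_mul _ .of_discrete, lintegral_add_left .of_discrete,
        lintegral_exp_poissonMeasure, lintegral_exp_poissonMeasure]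
    _ ≤ ENNReal.ofReal (s ^ p * K) * (ENNReal.ofReal (Real.exp 1) + ENNReal.ofReal (Real.exp 1)) := by
      have hs0 : 0 < s⁻¹ := by positivity
      gcongr ENNReal.ofReal (s ^ p * K) * (ENNReal.ofReal ?_ + ENNReal.ofReal ?_)
      · exact hmgf _ (abs_of_pos hs0)
      · exact hmgf _ (by rw [abs_neg, abs_of_pos hs0])
    _ = _ := by
      rw [← ENNReal.ofReal_add (by positivity) (by positivity),
        ← ENNReal.ofReal_mul (by positivity), hs, Real.sqrt_eq_rpow, ← Real.rpow_mul (by positivity)]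
      congr 1
      rw [one_div_mul_eq_div]
      ring

end PoissonMoments

/-! ### Measurability of the cost and its dependence on the law only -/

section PoissonProcess

variable {d : ℕ} {Ω : Type*} [MeasurableSpace Ω] {P : Measure Ω}
  {μ : Ω → Measure (EuclideanSpace ℝ (Fin d))}

theorem IsPoissonPointProcess.measurable_apply (hμ : IsPoissonPointProcess P μ)
    {A : Set (EuclideanSpace ℝ (Fin d))} (hA : MeasurableSet A) : Measurable fun ω => μ ω A :=
  (Measure.measurable_coe hA).comp hμ.measurable

theorem IsPoissonPointProcess.lintegral_comp (hμ : IsPoissonPointProcess P μ)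
    {A : Set (EuclideanSpace ℝ (Fin d))} (hA : MeasurableSet A) (hV : volume A ≠ ∞)
    {f : ℝ≥0∞ → ℝ≥0∞} (hf : Measurable f) :
    ∫⁻ ω, f (μ ω A) ∂P = ∫⁻ n : ℕ, f n ∂poissonMeasure (volume A).toNNReal := by
  rw [← lintegral_map hf (hμ.measurable_apply hA), hμ.law A hA hV,
    lintegral_map hf .of_discrete]

theorem IsPoissonPointProcess.lintegral_apply (hμ : IsPoissonPointProcess P μ)
    {A : Set (EuclideanSpace ℝ (Fin d))} (hA : MeasurableSet A) (hV : volume A ≠ ∞) :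
    ∫⁻ ω, μ ω A ∂P = volume A := by
  refine (hμ.lintegral_comp hA hV measurable_id).trans ?_
  simp [lintegral_natCast_poissonMeasure, ENNReal.coe_toNNReal hV]

theorem IsPoissonPointProcess.ae_eq_zero (hμ : IsPoissonPointProcess P μ)
    {A : Set (EuclideanSpace ℝ (Fin d))} (hA : MeasurableSet A) (hV : volume A = 0) :
    ∀ᵐ ω ∂P, μ ω A = 0 := by
  have h := hμ.lintegral_apply hA (by simp [hV])
  rw [hV, lintegral_eq_zero_iff (hμ.measurable_apply hA)] at h
  exact h

/-- The number of points in a set. -/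
noncomputable def pointCount (m : Measure (EuclideanSpace ℝ (Fin d)))
    (A : Set (EuclideanSpace ℝ (Fin d))) : ℕ := ⌊(m A).toReal⌋₊

theorem IsPoissonPointProcess.measurable_pointCount (hμ : IsPoissonPointProcess P μ)
    {A : Set (EuclideanSpace ℝ (Fin d))} (hA : MeasurableSet A) :
    Measurable fun ω => pointCount (μ ω) A :=
  Nat.measurable_floor.comp (hμ.measurable_apply hA).ennreal_toReal

theorem IsPoissonPointProcess.ae_eq_pointCount (hμ : IsPoissonPointProcess P μ)
    {A : Set (EuclideanSpace ℝ (Fin d))} (hA : MeasurableSet A) (hV : volume A ≠ ∞) :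
    ∀ᵐ ω ∂P, μ ω A = pointCount (μ ω) A := by
  have hm : Measurable fun y : ℝ≥0∞ => ((⌊y.toReal⌋₊ : ℕ) : ℝ≥0∞) :=
    Measurable.of_discrete.comp (Nat.measurable_floor.comp ENNReal.measurable_toReal)
  have h : ∀ᵐ y ∂(P.map fun ω => μ ω A), y = ((⌊y.toReal⌋₊ : ℕ) : ℝ≥0∞) := by
    rw [hμ.law A hA hV, ae_map_iff Measurable.of_discrete.aemeasurable
      (measurableSet_eq_fun measurable_id' hm)]
    exact .of_forall fun n => by simp
  exact ae_of_ae_map (hμ.measurable_apply hA).aemeasurable h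

/-- Independence and the one-set laws determine the joint law of the counts, so it is common to all
Poisson processes. -/
theorem IsPoissonPointProcess.map_pointCount (hμ : IsPoissonPointProcess P μ)
    [IsProbabilityMeasure P] {k : ℕ}
    {A : Fin k → Set (EuclideanSpace ℝ (Fin d))} (hA : ∀ j, MeasurableSet (A j))
    (hdisj : Pairwise (Function.onFun Disjoint A)) (hV : ∀ j, volume (A j) ≠ ∞) :
    P.map (fun ω j => pointCount (μ ω) (A j)) =
      Measure.pi fun j => poissonMeasure (volume (A j)).toNNReal := by
  have hfl : Measurable fun y : ℝ≥0∞ => ⌊y.toReal⌋₊ :=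
    Nat.measurable_floor.comp ENNReal.measurable_toReal
  have h := (hμ.indep k A hA hdisj).comp (fun _ y => ⌊y.toReal⌋₊) fun _ => hfl
  have h2 := (iIndepFun_iff_map_fun_eq_pi_map
    fun j => (hμ.measurable_pointCount (hA j)).aemeasurable).1 h
  refine h2.trans ?_
  congr 1
  ext1 j
  have e : P.map (fun ω => pointCount (μ ω) (A j)) =
      (P.map fun ω => μ ω (A j)).map fun y => ⌊y.toReal⌋₊ := by
    rw [Measure.map_map hfl (hμ.measurable_apply (hA j))]
    rfl
  refine e.trans ?_
  rw [hμ.law _ (hA j) (hV j), Measure.map_map hfl .of_discrete]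
  convert Measure.map_id
  ext n
  simp

theorem volume_rectangle_ne_top (x : EuclideanSpace ℝ (Fin d)) (ℓ : Fin d → ℝ) :
    volume (rectangle x ℓ) ≠ ∞ := (isCompact_rectangle x ℓ).measure_lt_top.ne

/-- An infimum over uncountably many couplings is not visibly measurable. Its root is, however, an
almost sure limit of functions of finitely many integer-valued counts, squeezed between vanishing
errors. -/
theorem IsPoissonPointProcess.aemeasurable_rectangleCost
    (hμ : IsPoissonPointProcess P μ) {p : ℝ} (hp : 1 ≤ p)
    (x : EuclideanSpace ℝ (Fin d)) {ℓ : Fin d → ℝ} (hℓ : ∀ j, 0 < ℓ j) :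
    AEMeasurable (fun ω => rectangleCost p (μ ω) x ℓ) P := by
  have hp0 : 0 < p := by linarith
  set ε : ℕ → ℝ≥0∞ := fun n => ((n : ℝ≥0∞) + 1)⁻¹ with hε
  have hε0 : ∀ n, ε n ≠ 0 := fun n => ENNReal.inv_ne_zero.2 (by simp)
  have hεt : Filter.Tendsto ε Filter.atTop (nhds 0) := by
    have := (Filter.tendsto_add_atTop_iff_nat 1).2 ENNReal.tendsto_inv_nat_nhds_zero
    simpa [hε] using this
  choose k A G hA hdisj hsub hG using fun n => exists_approx_by_counts hp x ℓ (hε0 n)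
  have hroot : AEMeasurable (fun ω => rectangleCost p (μ ω) x ℓ ^ (1 / p)) P := by
    refine aemeasurable_of_tendsto_metrizable_ae Filter.atTop
      (f := fun n ω => G n fun j => pointCount (μ ω) (A n j)) (fun n => ?_) ?_
    · exact (Measurable.of_discrete.comp (measurable_pi_lambda _ fun j =>
        hμ.measurable_pointCount (hA n j))).aemeasurable
    · have h : ∀ᵐ ω ∂P, ∀ n, ∀ j, μ ω (A n j) = pointCount (μ ω) (A n j) :=
        ae_all_iff.2 fun n => ae_all_iff.2 fun j => hμ.ae_eq_pointCount (hA n j)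
          (measure_ne_top_of_subset (hsub n j) (volume_rectangle_ne_top x ℓ))
      filter_upwards [h] with ω hω
      have := hμ.locallyFinite ω
      have hb := fun n => hG n (μ ω) _ (hω n)
      set D := rectangleCost p (μ ω) x ℓ ^ (1 / p)
      have hf : μ ω (rectangle x ℓ) ≠ ∞ := (isCompact_rectangle x ℓ).measure_lt_top.ne
      have hD : D ≠ ∞ := by
        refine ENNReal.rpow_ne_top_of_nonneg (by positivity) (ne_top_of_le_ne_top ?_
          (rectangleCost_le hp0.le (μ ω) x hℓ (s := ∑ j, ℓ j) (fun j => Finset.single_le_sum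
            (fun i _ => (hℓ i).le) (Finset.mem_univ j)) (Finset.sum_nonneg fun i _ => (hℓ i).le)))
        exact ENNReal.mul_ne_top (ENNReal.rpow_ne_top_of_nonneg hp0.le ENNReal.ofReal_ne_top) hf
      have ht : Filter.Tendsto (fun n => ε n * μ ω (rectangle x ℓ) ^ (1 / p)) Filter.atTop
          (nhds 0) := by
        simpa using ENNReal.Tendsto.mul_const hεt
          (Or.inr (ENNReal.rpow_ne_top_of_nonneg (by positivity : 0 ≤ 1 / p) hf))
      refine tendsto_of_tendsto_of_tendsto_of_le_of_le
        (g := fun n => D - ε n * μ ω (rectangle x ℓ) ^ (1 / p))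
        (h := fun n => D + ε n * μ ω (rectangle x ℓ) ^ (1 / p)) ?_ ?_
        (fun n => tsub_le_iff_right.2 (hb n).1) (fun n => (hb n).2)
      · simpa using ENNReal.Tendsto.sub (tendsto_const_nhds (x := D)) ht (Or.inl hD)
      · simpa using (tendsto_const_nhds (x := D)).add ht
  have := hroot.pow_const p
  simpa only [← ENNReal.rpow_mul, one_div_mul_cancel hp0.ne', ENNReal.rpow_one] using this

/-- The expected cost on a rectangle depends only on the law of the counts. -/
theorem IsPoissonPointProcess.lintegral_rectangleCost_le [IsProbabilityMeasure P]
    {μ' : Ω → Measure (EuclideanSpace ℝ (Fin d))}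
    (hμ : IsPoissonPointProcess P μ) (hμ' : IsPoissonPointProcess P μ') {p : ℝ} (hp : 1 ≤ p)
    (x : EuclideanSpace ℝ (Fin d)) {ℓ : Fin d → ℝ} (hℓ : ∀ j, 0 < ℓ j) :
    ∫⁻ ω, rectangleCost p (μ ω) x ℓ ∂P ≤ ∫⁻ ω, rectangleCost p (μ' ω) x ℓ ∂P := by
  have hp0 : 0 < p := by linarith
  have hp1 : 0 ≤ 1 / p := by positivity
  have hR := measurableSet_rectangle x ℓ
  have hVR := volume_rectangle_ne_top x ℓ
  rw [← ENNReal.rpow_le_rpow_iff (one_div_pos.2 hp0)]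
  have hcancel : ∀ s : ℝ≥0∞, (s ^ (1 / p)) ^ p = s := fun s => by
    rw [← ENNReal.rpow_mul, one_div_mul_cancel hp0.ne', ENNReal.rpow_one]
  have key : ∀ ε : ℝ≥0∞, ε ≠ 0 → (∫⁻ ω, rectangleCost p (μ ω) x ℓ ∂P) ^ (1 / p) ≤
      (∫⁻ ω, rectangleCost p (μ' ω) x ℓ ∂P) ^ (1 / p) +
        ε * (2 * volume (rectangle x ℓ) ^ (1 / p)) := by
    intro ε hε
    obtain ⟨k, A, G, hA, hdisj, hsub, hG⟩ := exists_approx_by_counts hp x ℓ hε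
    have hVA : ∀ j, volume (A j) ≠ ∞ := fun j => measure_ne_top_of_subset (hsub j) hVR
    -- The L^p(P) norm of the approximation error is exact, since the expected number of points is
    -- the volume.
    have herr : ∀ {μ₀ : Ω → Measure (EuclideanSpace ℝ (Fin d))}, IsPoissonPointProcess P μ₀ →
        (∫⁻ ω, (ε * μ₀ ω (rectangle x ℓ) ^ (1 / p)) ^ p ∂P) ^ (1 / p) =
          ε * volume (rectangle x ℓ) ^ (1 / p) := by
      intro μ₀ hμ₀
      simp only [ENNReal.mul_rpow_of_nonneg _ _ hp0.le, hcancel]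
      rw [lintegral_const_mul _ (hμ₀.measurable_apply hR), hμ₀.lintegral_apply hR hVR,
        ENNReal.mul_rpow_of_nonneg _ _ hp1, ← ENNReal.rpow_mul,
        mul_one_div_cancel hp0.ne', ENNReal.rpow_one]
    have hN : ∀ {μ₀ : Ω → Measure (EuclideanSpace ℝ (Fin d))}, IsPoissonPointProcess P μ₀ →
        Measurable fun ω j => pointCount (μ₀ ω) (A j) := fun hμ₀ =>
      measurable_pi_lambda _ fun j => hμ₀.measurable_pointCount (hA j)
    have hlaw : ∫⁻ ω, G (fun j => pointCount (μ ω) (A j)) ^ p ∂P =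
        ∫⁻ ω, G (fun j => pointCount (μ' ω) (A j)) ^ p ∂P := by
      rw [← lintegral_map (f := fun v => G v ^ p) .of_discrete (hN hμ),
        ← lintegral_map (f := fun v => G v ^ p) .of_discrete (hN hμ'),
        hμ.map_pointCount hA hdisj hVA, hμ'.map_pointCount hA hdisj hVA]
    have hae : ∀ {μ₀ : Ω → Measure (EuclideanSpace ℝ (Fin d))}, IsPoissonPointProcess P μ₀ →
        ∀ᵐ ω ∂P, ∀ j, μ₀ ω (A j) = pointCount (μ₀ ω) (A j) := fun hμ₀ =>
      ae_all_iff.2 fun j => hμ₀.ae_eq_pointCount (hA j) (hVA j)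
    have hmeas : ∀ {μ₀ : Ω → Measure (EuclideanSpace ℝ (Fin d))}, IsPoissonPointProcess P μ₀ →
        AEMeasurable (fun ω => ε * μ₀ ω (rectangle x ℓ) ^ (1 / p)) P := fun hμ₀ =>
      (((hμ₀.measurable_apply hR).pow_const _).const_mul _).aemeasurable
    have h1 : (∫⁻ ω, rectangleCost p (μ ω) x ℓ ∂P) ^ (1 / p) ≤
        (∫⁻ ω, G (fun j => pointCount (μ ω) (A j)) ^ p ∂P) ^ (1 / p) +
          ε * volume (rectangle x ℓ) ^ (1 / p) := by
      rw [← herr hμ]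
      refine le_trans (ENNReal.rpow_le_rpow (lintegral_mono_ae ?_) hp1)
        (ENNReal.lintegral_Lp_add_le
          (Measurable.of_discrete.comp (hN hμ)).aemeasurable (hmeas hμ) hp)
      filter_upwards [hae hμ] with ω hω
      have := hμ.locallyFinite ω
      rw [← hcancel (rectangleCost p (μ ω) x ℓ)]
      exact ENNReal.rpow_le_rpow (hG (μ ω) _ hω).1 hp0.le
    have h2 : (∫⁻ ω, G (fun j => pointCount (μ' ω) (A j)) ^ p ∂P) ^ (1 / p) ≤
        (∫⁻ ω, rectangleCost p (μ' ω) x ℓ ∂P) ^ (1 / p) +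
          ε * volume (rectangle x ℓ) ^ (1 / p) := by
      rw [← herr hμ']
      have hc : (∫⁻ ω, rectangleCost p (μ' ω) x ℓ ∂P) =
          ∫⁻ ω, (rectangleCost p (μ' ω) x ℓ ^ (1 / p)) ^ p ∂P := by simp only [hcancel]
      rw [hc]
      refine le_trans (ENNReal.rpow_le_rpow (lintegral_mono_ae ?_) hp1)
        (ENNReal.lintegral_Lp_add_le
          ((hμ'.aemeasurable_rectangleCost hp x hℓ).pow_const _) (hmeas hμ') hp)
      filter_upwards [hae hμ'] with ω hω
      have := hμ'.locallyFinite ω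
      exact ENNReal.rpow_le_rpow (hG (μ' ω) _ hω).2 hp0.le
    rw [hlaw] at h1
    calc _ ≤ _ := h1.trans (add_le_add h2 le_rfl)
      _ = _ := by ring
  set c := 2 * volume (rectangle x ℓ) ^ (1 / p) with hc
  have hct : c ≠ ∞ := ENNReal.mul_ne_top (by simp) (ENNReal.rpow_ne_top_of_nonneg hp1 hVR)
  -- At `n = 0` the inverse is ∞, which is harmless: `key` only asks for a nonzero error.
  have hε0 : ∀ n : ℕ, (n : ℝ≥0∞)⁻¹ ≠ 0 := fun n => ENNReal.inv_ne_zero.2 (by simp)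
  have ht : Filter.Tendsto (fun n : ℕ => (∫⁻ ω, rectangleCost p (μ' ω) x ℓ ∂P) ^ (1 / p) +
      (n : ℝ≥0∞)⁻¹ * c) Filter.atTop
      (nhds ((∫⁻ ω, rectangleCost p (μ' ω) x ℓ ∂P) ^ (1 / p) + 0 * c)) :=
    tendsto_const_nhds.add (ENNReal.Tendsto.mul_const ENNReal.tendsto_inv_nat_nhds_zero
      (Or.inr hct))
  rw [zero_mul, add_zero] at ht
  exact ge_of_tendsto' ht fun n => key _ (hε0 n)

/-- Translates of a Poisson process are Poisson processes. -/
theorem IsPoissonPointProcess.map_add_right (hμ : IsPoissonPointProcess P μ)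
    (x : EuclideanSpace ℝ (Fin d)) :
    IsPoissonPointProcess P fun ω => (μ ω).map (· + x) := by
  have hm : Measurable fun y : EuclideanSpace ℝ (Fin d) => y + x := measurable_add_const x
  have happ : ∀ ω {A : Set (EuclideanSpace ℝ (Fin d))}, MeasurableSet A →
      (μ ω).map (· + x) A = μ ω ((· + x) ⁻¹' A) := fun ω A hA => Measure.map_apply hm hA
  refine ⟨(Measure.measurable_map _ hm).comp hμ.measurable, fun ω => ?_, fun ω => ?_, ?_, ?_⟩
  · have := hμ.locallyFinite ω
    refine ⟨fun y => ?_⟩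
    obtain ⟨s, hys, hs, hfin⟩ := (μ ω).exists_isOpen_measure_lt_top (y - x)
    have hs' : IsOpen ((· - x) ⁻¹' s) := hs.preimage (continuous_sub_right x)
    refine ⟨_, hs'.mem_nhds hys, ?_⟩
    rw [happ ω hs'.measurableSet, ← Set.preimage_comp]
    simpa [Function.comp_def] using hfin
  · obtain ⟨I, X, h⟩ := hμ.atomic ω
    refine ⟨I, fun n => X n + x, ?_⟩
    rw [h, Measure.map_sum hm.aemeasurable]
    congr 1
    ext1 i
    exact Measure.map_dirac' hm _
  · intro k A hA hdisj
    have := hμ.indep k (fun j => (· + x) ⁻¹' A j) (fun j => hm (hA j)) fun i j hij =>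
      (hdisj hij).preimage _
    simpa only [happ _ (hA _)] using this
  · intro A hA hV
    have e : volume ((· + x) ⁻¹' A) = volume A := measure_preimage_add_right volume x A
    have := hμ.law ((· + x) ⁻¹' A) (hm hA) (e ▸ hV)
    simpa only [happ _ hA, e] using this

end PoissonProcess

/-! ### Expected costs: stationarity and the effect of one cut -/

section Expectation

variable {d : ℕ} {Ω : Type*} [MeasurableSpace Ω] {P : Measure Ω}
  {μ : Ω → Measure (EuclideanSpace ℝ (Fin d))}

theorem fref_rectangle (P : Measure Ω) (μ : Ω → Measure (EuclideanSpace ℝ (Fin d))) (p : ℝ)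
    (x : EuclideanSpace ℝ (Fin d)) {ℓ : Fin d → ℝ} (hℓ : ∀ j, 0 < ℓ j) :
    fref P μ p (rectangle x ℓ) =
      ENNReal.ofReal (∏ j, ℓ j)⁻¹ * ∫⁻ ω, rectangleCost p (μ ω) x ℓ ∂P := by
  simp only [fref, refCost_rectangle p _ x hℓ]
  rw [lintegral_const_mul' _ _ ENNReal.ofReal_ne_top]

theorem lintegral_rectangleCost (P : Measure Ω) (μ : Ω → Measure (EuclideanSpace ℝ (Fin d)))
    (p : ℝ) (x : EuclideanSpace ℝ (Fin d)) {ℓ : Fin d → ℝ} (hℓ : ∀ j, 0 < ℓ j) :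
    ∫⁻ ω, rectangleCost p (μ ω) x ℓ ∂P =
      ENNReal.ofReal (∏ j, ℓ j) * fref P μ p (rectangle x ℓ) := by
  have hV : 0 < ∏ j, ℓ j := Finset.prod_pos fun j _ => hℓ j
  rw [fref_rectangle P μ p x hℓ, ← mul_assoc, ← ENNReal.ofReal_mul hV.le, mul_inv_cancel₀ hV.ne',
    ENNReal.ofReal_one, one_mul]

theorem IsPoissonPointProcess.aemeasurable_refCost (hμ : IsPoissonPointProcess P μ) {p : ℝ}
    (hp : 1 ≤ p) (x : EuclideanSpace ℝ (Fin d)) {ℓ : Fin d → ℝ} (hℓ : ∀ j, 0 < ℓ j) :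
    AEMeasurable (fun ω => refCost p (rectangle x ℓ) (μ ω)) P := by
  simp only [refCost_rectangle p _ x hℓ]
  exact (hμ.aemeasurable_rectangleCost hp x hℓ).const_mul _

/-- The trivial bound by the size of the rectangle. -/
theorem IsPoissonPointProcess.fref_rectangle_le (hμ : IsPoissonPointProcess P μ) {p : ℝ}
    (hp : 1 ≤ p) (x : EuclideanSpace ℝ (Fin d)) {ℓ : Fin d → ℝ} (hℓ : ∀ j, 0 < ℓ j) {s : ℝ}
    (hs0 : 0 ≤ s) (hs : ∀ j, ℓ j ≤ s) :
    fref P μ p (rectangle x ℓ) ^ (1 / p) ≤ ENNReal.ofReal (d * s) := by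
  have hp0 : 0 < p := by linarith
  have hV : 0 < ∏ j, ℓ j := Finset.prod_pos fun j _ => hℓ j
  rw [one_div, ENNReal.rpow_inv_le_iff hp0, fref_rectangle P μ p x hℓ]
  calc ENNReal.ofReal (∏ j, ℓ j)⁻¹ * ∫⁻ ω, rectangleCost p (μ ω) x ℓ ∂P
      ≤ ENNReal.ofReal (∏ j, ℓ j)⁻¹ *
        ∫⁻ ω, ENNReal.ofReal (d * s) ^ p * μ ω (rectangle x ℓ) ∂P := by
        gcongr with ω
        have := hμ.locallyFinite ω
        exact rectangleCost_le hp0.le (μ ω) x hℓ hs hs0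
    _ = ENNReal.ofReal (d * s) ^ p := by
        rw [lintegral_const_mul _ (hμ.measurable_apply (measurableSet_rectangle x ℓ)),
          hμ.lintegral_apply (measurableSet_rectangle x ℓ) (volume_rectangle_ne_top x ℓ),
          volume_rectangle x fun j => (hℓ j).le, mul_left_comm, ← ENNReal.ofReal_mul
          (by positivity), inv_mul_cancel₀ hV.ne', ENNReal.ofReal_one, mul_one]

theorem transportCost_map_isometry_le {E : Type*} [MeasurableSpace E] [PseudoEMetricSpace E]
    [OpensMeasurableSpace E] [SecondCountableTopology E] {p : ℝ} {T : E → E} (hT : Isometry T)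
    (hTm : Measurable T) (μ ν : Measure E) :
    transportCost p (μ.map T) (ν.map T) ≤ transportCost p μ ν := by
  refine le_iInf₂ fun π hπ => ?_
  have hm := hTm.prodMap hTm
  have hc : IsCoupling (π.map (Prod.map T T)) (μ.map T) (ν.map T) := by
    constructor
    · rw [← hπ.1, Measure.map_map measurable_fst hm, Measure.map_map hTm measurable_fst]
      rfl
    · rw [← hπ.2, Measure.map_map measurable_snd hm, Measure.map_map hTm measurable_snd]
      rfl
  refine (transportCost_le hc).trans (le_of_eq ?_)
  rw [lintegral_map (by fun_prop) hm]
  simp [hT.edist_eq]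

theorem rectangleCost_map_add_right_le (p : ℝ) (m : Measure (EuclideanSpace ℝ (Fin d)))
    (x : EuclideanSpace ℝ (Fin d)) (ℓ : Fin d → ℝ) :
    rectangleCost p (m.map (· + x)) x ℓ ≤ rectangleCost p m 0 ℓ := by
  have hm : Measurable fun y : EuclideanSpace ℝ (Fin d) => y + x := measurable_add_const x
  have hpre : (fun y : EuclideanSpace ℝ (Fin d) => y + x) ⁻¹' rectangle x ℓ = rectangle 0 ℓ := by
    ext y
    refine forall_congr' fun j => ?_
    simp only [PiLp.add_apply, PiLp.zero_apply, zero_add, le_add_iff_nonneg_left]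
    rw [add_comm (x j), add_le_add_iff_right]
  have hu : uniformRectangle x ℓ = (uniformRectangle 0 ℓ).map (· + x) := by
    rw [uniformRectangle, uniformRectangle, Measure.map_map hm (measurable_rectangleMap 0 ℓ)]
    congr 1
    ext u j
    simp [add_comm]
  rw [rectangleCost, rectangleCost, Measure.restrict_map hm (measurableSet_rectangle x ℓ),
    Measure.map_apply hm (measurableSet_rectangle x ℓ), hpre, hu, ← Measure.map_smul]
  exact transportCost_map_isometry_le (IsometryEquiv.addRight x).isometry hm _ _

/-- The process may be replaced by its translate by `x`, which is Poisson too; translating back then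
brings the rectangle to the origin. -/
theorem IsPoissonPointProcess.fref_rectangle_translate_le [IsProbabilityMeasure P]
    (hμ : IsPoissonPointProcess P μ) {p : ℝ} (hp : 1 ≤ p) (x : EuclideanSpace ℝ (Fin d))
    {ℓ : Fin d → ℝ} (hℓ : ∀ j, 0 < ℓ j) :
    fref P μ p (rectangle x ℓ) ≤ fref P μ p (rectangle 0 ℓ) := by
  rw [fref_rectangle P μ p x hℓ, fref_rectangle P μ p 0 hℓ]
  gcongr _ * ?_
  exact (hμ.lintegral_rectangleCost_le (hμ.map_add_right x) hp x hℓ).trans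
    (lintegral_mono fun ω => rectangleCost_map_add_right_le p (μ ω) x ℓ)

theorem add_rpow_le_two_rpow_mul {p a b : ℝ} (hp : 0 ≤ p) (ha : 0 ≤ a) (hb : 0 ≤ b) :
    (a + b) ^ p ≤ 2 ^ p * (a ^ p + b ^ p) := by
  have h1 : (a + b) ^ p ≤ (2 * max a b) ^ p := by
    gcongr
    linarith [le_max_left a b, le_max_right a b]
  refine h1.trans ?_
  rw [Real.mul_rpow zero_le_two (le_max_of_le_left ha)]
  gcongr
  have := Real.rpow_nonneg ha p
  have := Real.rpow_nonneg hb p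
  rcases max_cases a b with ⟨h, _⟩ | ⟨h, _⟩ <;> rw [h] <;> linarith

/-- Splitting a rectangle changes the normalized cost by a power of the volume. -/
theorem exists_fref_split_le {p : ℝ} (hp : 1 ≤ p) :
    ∃ C : ℝ, 0 < C ∧ ∀ {d : ℕ} {Ω : Type*} [MeasurableSpace Ω] {P : Measure Ω}
      {μ : Ω → Measure (EuclideanSpace ℝ (Fin d))}, IsPoissonPointProcess P μ →
      ∀ (x : EuclideanSpace ℝ (Fin d)) {ℓ : Fin d → ℝ} (_ : ∀ j, 0 < ℓ j) (i : Fin d) {θ : ℝ}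
        (_ : 0 < θ) (_ : θ < 1) (_ : 1 ≤ θ * ∏ j, ℓ j) {B : ℝ≥0∞}
        (_ : fref P μ p (rectangle x (Function.update ℓ i (θ * ℓ i))) ^ (1 / p) ≤ B)
        (_ : fref P μ p (rectangle (x + EuclideanSpace.single i (θ * ℓ i))
          (Function.update ℓ i ((1 - θ) * ℓ i))) ^ (1 / p) ≤ B),
        fref P μ p (rectangle x ℓ) ^ (1 / p) ≤
          B + ENNReal.ofReal (C * ℓ i * (∏ j, ℓ j) ^ (-(1 / 2) : ℝ)) := by
  have hp0 : 0 < p := by linarith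
  have hp1 : 0 ≤ 1 / p := by positivity
  obtain ⟨M, hM, hmom⟩ := exists_lintegral_poissonMeasure_abs_sub_rpow_le hp0.le
  -- One factor 2^p comes from `displacement_bound`, the other from separating the two deviations;
  -- each deviation contributes one moment constant `M`.
  set K := 2 ^ p * (2 ^ p * (M + M)) with hK
  have hK0 : 0 < K := by positivity
  refine ⟨K ^ (1 / p), by positivity, ?_⟩
  intro d Ω _ P μ hμ x ℓ hℓ i θ h0 h1 hV1 B hB₁ hB₂
  set V := ∏ j, ℓ j with hVdef
  have hV : 0 < V := Finset.prod_pos fun j _ => hℓ j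
  have hVge : 1 ≤ V := hV1.trans (by nlinarith)
  have h1' : 0 < 1 - θ := sub_pos.2 h1
  have hi := hℓ i
  have ha : 0 < θ * ℓ i := by positivity
  have hb : 0 < (1 - θ) * ℓ i := by positivity
  have hℓ₁ := update_pos (i := i) hℓ ha
  have hℓ₂ := update_pos (i := i) hℓ hb
  set x₂ := x + EuclideanSpace.single i (θ * ℓ i) with hx₂
  set R := rectangle x ℓ with hR
  set R₁ := rectangle x (Function.update ℓ i (θ * ℓ i)) with hR₁
  have hRm : MeasurableSet R := measurableSet_rectangle _ _
  have hRm₁ : MeasurableSet R₁ := measurableSet_rectangle _ _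
  have hvol : volume R = ENNReal.ofReal V := volume_rectangle x fun j => (hℓ j).le
  have hvol₁ : volume R₁ = ENNReal.ofReal (θ * V) := by
    rw [hR₁, volume_rectangle x fun j => (hℓ₁ j).le, prod_update_mul]
  have hcancel : ∀ s : ℝ≥0∞, (s ^ (1 / p)) ^ p = s := fun s => by
    rw [← ENNReal.rpow_mul, one_div_mul_cancel hp0.ne', ENNReal.rpow_one]
  -- Only the counts of the first part and of the whole enter, so only their volumes need to be at
  -- least 1.
  have hmom' : ∀ {A : Set (EuclideanSpace ℝ (Fin d))} {v : ℝ}, MeasurableSet A →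
      volume A = ENNReal.ofReal v → 1 ≤ v → v ≤ V →
      ∫⁻ ω, ENNReal.ofReal (|(μ ω A).toReal - v| ^ p) ∂P ≤ ENNReal.ofReal (M * V ^ (p / 2)) := by
    intro A v hA hv hv1 hvV
    have hf : Measurable fun y : ℝ≥0∞ => ENNReal.ofReal (|y.toReal - v| ^ p) := by fun_prop
    have hr : (volume A).toNNReal = v.toNNReal := by rw [hv]; rfl
    have hvc : (v.toNNReal : ℝ) = v := Real.coe_toNNReal v (by linarith)
    have := hmom v.toNNReal (by simpa using hv1)
    rw [hvc] at this
    rw [hμ.lintegral_comp hA (by simp [hv]) hf, hr]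
    simp only [ENNReal.toReal_natCast]
    refine this.trans (ENNReal.ofReal_le_ofReal ?_)
    gcongr
  set c₁ : Ω → ℝ≥0∞ := fun ω => rectangleCost p (μ ω) x (Function.update ℓ i (θ * ℓ i)) with hc₁
  set c₂ : Ω → ℝ≥0∞ := fun ω => rectangleCost p (μ ω) x₂ (Function.update ℓ i ((1 - θ) * ℓ i))
    with hc₂
  set g : Ω → ℝ≥0∞ := fun ω => μ ω R * ENNReal.ofReal |θ * ℓ i - (μ ω R₁).toReal /
    (μ ω R).toReal * ℓ i| ^ p with hg
  have hc₁m : AEMeasurable c₁ P := hμ.aemeasurable_rectangleCost hp _ hℓ₁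
  have hc₂m : AEMeasurable c₂ P := hμ.aemeasurable_rectangleCost hp _ hℓ₂
  have mR := hμ.measurable_apply hRm
  have mR₁ := hμ.measurable_apply hRm₁
  have hgm : Measurable g := by fun_prop
  -- Minkowski's inequality in L^p(P) integrates the pathwise inequality between roots, valid almost
  -- surely because the cutting face has no points.
  have hroot : (∫⁻ ω, rectangleCost p (μ ω) x ℓ ∂P) ^ (1 / p) ≤
      (∫⁻ ω, c₁ ω + c₂ ω ∂P) ^ (1 / p) + (∫⁻ ω, g ω ∂P) ^ (1 / p) := by
    have := ENNReal.lintegral_Lp_add_le (μ := P) ((hc₁m.add hc₂m).pow_const (1 / p))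
      (hgm.pow_const (1 / p)).aemeasurable hp
    simp only [hcancel] at this
    refine le_trans (ENNReal.rpow_le_rpow (lintegral_mono_ae ?_) hp1) this
    filter_upwards [hμ.ae_eq_zero (measurableSet_rectangle _ _)
      (volume_splitFace (i := i) (a := θ * ℓ i) x fun j => (hℓ j).le)] with ω hω
    have := hμ.locallyFinite ω
    rw [← hcancel (rectangleCost p (μ ω) x ℓ)]
    exact ENNReal.rpow_le_rpow (rectangleCost_split_le hp (μ ω) x hℓ ha.le hb.le (by ring) hω)
      hp0.le
  -- The volume weights θ and 1 - θ add up to 1, so the common bound `B` passes to the whole without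
  -- loss.
  have hsum : ∫⁻ ω, c₁ ω + c₂ ω ∂P ≤ ENNReal.ofReal V * B ^ p := by
    have hB' : ∀ {s : ℝ≥0∞}, s ^ (1 / p) ≤ B → s ≤ B ^ p := fun {s} hs => by
      rw [← hcancel s]
      exact ENNReal.rpow_le_rpow hs hp0.le
    rw [lintegral_add_left' hc₁m, lintegral_rectangleCost P μ p x hℓ₁,
      lintegral_rectangleCost P μ p x₂ hℓ₂, prod_update_mul, prod_update_mul]
    calc _ ≤ ENNReal.ofReal (θ * V) * B ^ p + ENNReal.ofReal ((1 - θ) * V) * B ^ p := by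
          gcongr
          · exact hB' hB₁
          · exact hB' hB₂
      _ = _ := by
          rw [← add_mul, ← ENNReal.ofReal_add (by positivity) (by positivity)]
          ring_nf
  have hgle : ∫⁻ ω, g ω ∂P ≤ ENNReal.ofReal (K * ℓ i ^ p * V ^ (1 - p) * V ^ (p / 2)) := by
    have hpt : ∀ ω, g ω ≤ ENNReal.ofReal (2 ^ p * (2 ^ p) * ℓ i ^ p * V ^ (1 - p)) *
        (ENNReal.ofReal (|(μ ω R₁).toReal - θ * V| ^ p) +
          ENNReal.ofReal (|(μ ω R).toReal - V| ^ p)) := by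
      intro ω
      have := hμ.locallyFinite ω
      have f : μ ω R ≠ ∞ := (isCompact_rectangle _ _).measure_lt_top.ne
      by_cases hz : μ ω R = 0
      · simp [hg, hz]
      have hn : 0 < (μ ω R).toReal := ENNReal.toReal_pos hz f
      have hsub : R₁ ⊆ R := by
        rw [hR, rectangle_split (i := i) ha.le hb.le (by ring)]
        exact Set.subset_union_left
      have hle : (μ ω R₁).toReal ≤ (μ ω R).toReal :=
        ENNReal.toReal_mono f (measure_mono hsub)
      have hd := displacement_bound hp hn ENNReal.toReal_nonneg hle h0.le h1.le hV hi.le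
      rw [← ENNReal.ofReal_add (by positivity) (by positivity), ← ENNReal.ofReal_mul (by positivity)]
      simp only [hg]
      nth_rw 1 [← ENNReal.ofReal_toReal f]
      rw [ENNReal.ofReal_rpow_of_nonneg (abs_nonneg _) hp0.le,
        ← ENNReal.ofReal_mul ENNReal.toReal_nonneg]
      refine ENNReal.ofReal_le_ofReal (hd.trans ?_)
      calc _ ≤ 2 ^ p * ℓ i ^ p * V ^ (1 - p) * (2 ^ p * (|(μ ω R₁).toReal - θ * V| ^ p +
            |(μ ω R).toReal - V| ^ p)) := by
            gcongr
            exact add_rpow_le_two_rpow_mul hp0.le (abs_nonneg _) (abs_nonneg _)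
        _ = _ := by ring
    have hθV : θ * V ≤ V := by nlinarith
    calc _ ≤ _ := lintegral_mono hpt
      _ = ENNReal.ofReal (2 ^ p * (2 ^ p) * ℓ i ^ p * V ^ (1 - p)) *
        (∫⁻ ω, ENNReal.ofReal (|(μ ω R₁).toReal - θ * V| ^ p) ∂P +
          ∫⁻ ω, ENNReal.ofReal (|(μ ω R).toReal - V| ^ p) ∂P) := by
          rw [lintegral_const_mul _ (by fun_prop), lintegral_add_left (by fun_prop)]
      _ ≤ ENNReal.ofReal (2 ^ p * (2 ^ p) * ℓ i ^ p * V ^ (1 - p)) *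
        (ENNReal.ofReal (M * V ^ (p / 2)) + ENNReal.ofReal (M * V ^ (p / 2))) := by
          gcongr
          · exact hmom' hRm₁ hvol₁ hV1 hθV
          · exact hmom' hRm hvol hVge le_rfl
      _ = _ := by
          rw [← ENNReal.ofReal_add (by positivity) (by positivity),
            ← ENNReal.ofReal_mul (by positivity)]
          congr 1
          rw [hK]
          ring
  rw [fref_rectangle P μ p x hℓ, ENNReal.mul_rpow_of_nonneg _ _ hp1]
  -- The powers of V combine to V^(-p/2), whose p-th root is the V^(-1/2) of the statement.
  have hpow : V⁻¹ * (K * ℓ i ^ p * V ^ (1 - p) * V ^ (p / 2)) =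
      (K ^ (1 / p) * ℓ i * V ^ (-(1 / 2) : ℝ)) ^ p := by
    rw [Real.mul_rpow (by positivity) (by positivity), Real.mul_rpow (by positivity) hi.le,
      ← Real.rpow_mul hK0.le, one_div_mul_cancel hp0.ne', Real.rpow_one, ← Real.rpow_mul hV.le,
      ← Real.rpow_neg_one V]
    have : V ^ (-(1 / 2) * p) = V ^ (-1 : ℝ) * V ^ (1 - p) * V ^ (p / 2) := by
      rw [← Real.rpow_add hV, ← Real.rpow_add hV]
      ring_nf
    rw [this]
    ring
  calc ENNReal.ofReal V⁻¹ ^ (1 / p) * (∫⁻ ω, rectangleCost p (μ ω) x ℓ ∂P) ^ (1 / p)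
      ≤ ENNReal.ofReal V⁻¹ ^ (1 / p) * ((ENNReal.ofReal V * B ^ p) ^ (1 / p) +
        (ENNReal.ofReal (K * ℓ i ^ p * V ^ (1 - p) * V ^ (p / 2))) ^ (1 / p)) := by
        gcongr
        exact hroot.trans (by gcongr)
    _ = B + ENNReal.ofReal (K ^ (1 / p) * ℓ i * V ^ (-(1 / 2) : ℝ)) := by
        rw [mul_add, ← ENNReal.mul_rpow_of_nonneg _ _ hp1, ← ENNReal.mul_rpow_of_nonneg _ _ hp1,
          ← mul_assoc, ← ENNReal.ofReal_mul (by positivity), ← ENNReal.ofReal_mul (by positivity),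
          hpow, inv_mul_cancel₀ hV.ne', ENNReal.ofReal_one, one_mul, ← ENNReal.rpow_mul,
          mul_one_div_cancel hp0.ne', ENNReal.rpow_one,
          ← ENNReal.ofReal_rpow_of_nonneg (by positivity) hp0.le, ← ENNReal.rpow_mul,
          mul_one_div_cancel hp0.ne', ENNReal.rpow_one]

end Expectation

/-! ### Summation over scales -/

section Multiscale

variable {d : ℕ}

/-- Every side is at least a third of the given one, so the volume is at least (ℓ i / 3)^d. -/
theorem side_le_of_ratio_le {ℓ : Fin d → ℝ} (hd : d ≠ 0) (hℓ : ∀ j, 0 < ℓ j)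
    (hr : ∀ i j, ℓ i ≤ 3 * ℓ j) (i : Fin d) : ℓ i ≤ 3 * (∏ j, ℓ j) ^ (1 / (d : ℝ)) := by
  have hV : 0 < ∏ j, ℓ j := Finset.prod_pos fun j _ => hℓ j
  have h : (ℓ i / 3) ^ d ≤ ∏ j, ℓ j := by
    calc (ℓ i / 3) ^ d = ∏ _j : Fin d, ℓ i / 3 := by
          rw [Finset.prod_const, Finset.card_univ, Fintype.card_fin]
      _ ≤ ∏ j, ℓ j := Finset.prod_le_prod (fun j _ => (div_pos (hℓ i) three_pos).le)
          fun j _ => by linarith [hr i j]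
  have := Real.rpow_le_rpow (pow_nonneg (div_pos (hℓ i) three_pos).le d) h
    (by positivity : 0 ≤ 1 / (d : ℝ))
  rw [one_div, Real.pow_rpow_inv_natCast (div_pos (hℓ i) three_pos).le hd] at this
  rw [one_div]
  linarith

/-- The splitting estimate in terms of a potential `A - K * volume ^ (-β)`, `β = 1 / 2 - 1 / d`,
whose increments absorb the errors of all scales. -/
theorem exists_fref_potential_step (hd : 3 ≤ d) {p : ℝ} (hp : 1 ≤ p) :
    ∃ K : ℝ, 0 < K ∧ ∀ {Ω : Type*} [MeasurableSpace Ω] {P : Measure Ω}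
      {μ : Ω → Measure (EuclideanSpace ℝ (Fin d))}, IsPoissonPointProcess P μ →
      ∀ (x : EuclideanSpace ℝ (Fin d)) {ℓ : Fin d → ℝ} (_ : ∀ j, 0 < ℓ j)
        (_ : ∀ i j, ℓ i ≤ 3 * ℓ j) (i : Fin d) {θ : ℝ}
        (_ : 1 / 3 ≤ θ) (_ : θ ≤ 2 / 3) (_ : 1 ≤ θ * ∏ j, ℓ j) {A : ℝ} {B : ℝ≥0∞}
        (_ : K * (θ * ∏ j, ℓ j) ^ (-(1 / 2 - 1 / d) : ℝ) ≤ A)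
        (_ : fref P μ p (rectangle x (Function.update ℓ i (θ * ℓ i))) ^ (1 / p) ≤
          B + ENNReal.ofReal (A - K * (θ * ∏ j, ℓ j) ^ (-(1 / 2 - 1 / d) : ℝ)))
        (_ : fref P μ p (rectangle (x + EuclideanSpace.single i (θ * ℓ i))
          (Function.update ℓ i ((1 - θ) * ℓ i))) ^ (1 / p) ≤
          B + ENNReal.ofReal (A - K * ((1 - θ) * ∏ j, ℓ j) ^ (-(1 / 2 - 1 / d) : ℝ))),
        fref P μ p (rectangle x ℓ) ^ (1 / p) ≤
          B + ENNReal.ofReal (A - K * (∏ j, ℓ j) ^ (-(1 / 2 - 1 / d) : ℝ)) := by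
  have hd' : (3 : ℝ) ≤ d := by exact_mod_cast hd
  obtain ⟨C, hC, hstep⟩ := exists_fref_split_le hp
  set β : ℝ := 1 / 2 - 1 / d with hβ
  have hβ0 : 0 < β := by
    rw [hβ, sub_pos]
    exact one_div_lt_one_div_of_lt two_pos (by linarith)
  -- Each part has at most 2/3 of the volume, so V^(-β) grows by at least the factor q > 1 in
  -- passing to it.
  set q : ℝ := (2 / 3 : ℝ) ^ (-β) with hq
  have hq1 : 1 < q := Real.one_lt_rpow_of_pos_of_lt_one_of_neg (by norm_num) (by norm_num)
    (by linarith)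
  have hq0 : 0 < q - 1 := sub_pos.2 hq1
  -- Chosen so that K(q - 1) = 3C: the gain of the potential in one cut pays exactly for the bound
  -- 3C V^(-β) on its error.
  refine ⟨3 * C / (q - 1), by positivity, ?_⟩
  intro Ω _ P μ hμ x ℓ hℓ hr i θ h1 h2 hV1 A B hA hB₁ hB₂
  set K := 3 * C / (q - 1) with hK
  have hK0 : 0 < K := by positivity
  set V := ∏ j, ℓ j with hVdef
  have hV : 0 < V := Finset.prod_pos fun j _ => hℓ j
  have hchild : ∀ t : ℝ, 0 < t → t ≤ 2 / 3 → q * V ^ (-β) ≤ (t * V) ^ (-β) := by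
    intro t ht0 ht
    rw [hq, ← Real.mul_rpow (by norm_num) hV.le]
    exact Real.rpow_le_rpow_of_nonpos (by positivity) (by gcongr) (by linarith)
  have hside := side_le_of_ratio_le (by omega) hℓ hr i
  have hmono : ∀ t : ℝ, 0 < t → t ≤ 2 / 3 → ENNReal.ofReal (A - K * (t * V) ^ (-β)) ≤
      ENNReal.ofReal (A - K * (q * V ^ (-β))) := fun t ht0 ht =>
    ENNReal.ofReal_le_ofReal (sub_le_sub_left (mul_le_mul_of_nonneg_left (hchild t ht0 ht) hK0.le) _)
  -- Nonnegativity keeps `ENNReal.ofReal` from truncating, so that the error can be added inside it.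
  have hA' : 0 ≤ A - K * (q * V ^ (-β)) := by
    have := mul_le_mul_of_nonneg_left (hchild θ (by linarith) h2) hK0.le
    linarith
  refine (hstep hμ x hℓ i (by linarith) (by linarith) hV1
    (hB₁.trans (add_le_add le_rfl (hmono θ (by linarith) h2)))
    (hB₂.trans (add_le_add le_rfl (hmono (1 - θ) (by linarith) (by linarith))))).trans ?_
  rw [add_assoc, ← ENNReal.ofReal_add hA' (by have := hℓ i; positivity)]
  gcongr
  have hVβ : V ^ (1 / (d : ℝ)) * V ^ (-(1 / 2) : ℝ) = V ^ (-β) := by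
    rw [← Real.rpow_add hV, hβ]
    ring_nf
  have h3 : C * ℓ i * V ^ (-(1 / 2) : ℝ) ≤ 3 * C * V ^ (-β) := by
    rw [← hVβ]
    calc C * ℓ i * V ^ (-(1 / 2) : ℝ) ≤ C * (3 * V ^ (1 / (d : ℝ))) * V ^ (-(1 / 2) : ℝ) := by
          gcongr
      _ = _ := by ring
  have h4 : 3 * C = K * (q - 1) := by rw [hK]; field_simp
  rw [h4] at h3
  linarith

/-- The uniform bound on rectangles of moderate aspect ratio. -/
theorem exists_fref_le (hd : 3 ≤ d) {p : ℝ} (hp : 1 ≤ p) :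
    ∃ A : ℝ, 0 < A ∧ ∀ {Ω : Type*} [MeasurableSpace Ω] {P : Measure Ω}
      {μ : Ω → Measure (EuclideanSpace ℝ (Fin d))}, IsPoissonPointProcess P μ →
      ∀ (x : EuclideanSpace ℝ (Fin d)) {ℓ : Fin d → ℝ}, ModerateAspectRatio ℓ →
        fref P μ p (rectangle x ℓ) ^ (1 / p) ≤ ENNReal.ofReal A := by
  have hd' : (3 : ℝ) ≤ d := by exact_mod_cast hd
  have : Nonempty (Fin d) := ⟨⟨0, by omega⟩⟩
  obtain ⟨K, hK, hstep⟩ := exists_fref_potential_step hd hp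
  set β : ℝ := 1 / 2 - 1 / d with hβ
  have hβ0 : 0 < β := by
    rw [hβ, sub_pos]
    exact one_div_lt_one_div_of_lt two_pos (by linarith)
  -- At volume at most 2, every side is at most 3 · 2^(1/d) ≤ 6.
  set a : ℝ := d * (3 * 2) with ha
  refine ⟨a + K, by positivity, ?_⟩
  intro Ω _ P μ hμ
  have hKle : ∀ {V : ℝ}, 1 ≤ V → K * V ^ (-β) ≤ K := fun hV =>
    mul_le_of_le_one_right hK.le (Real.rpow_le_one_of_one_le_of_nonpos hV (by linarith))
  have hratio : ∀ {ℓ : Fin d → ℝ}, ModerateAspectRatio ℓ → ∀ i j, ℓ i ≤ 3 * ℓ j :=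
    fun {ℓ} h i j => by
      have h1 := (div_le_iff₀ (h.1 j)).1 (h.2 i j)
      linarith [h.1 j]
  have hsmall : ∀ (x : EuclideanSpace ℝ (Fin d)) {ℓ : Fin d → ℝ}, ModerateAspectRatio ℓ →
      ∏ j, ℓ j ≤ 2 → fref P μ p (rectangle x ℓ) ^ (1 / p) ≤ ENNReal.ofReal a := by
    intro x ℓ h hV
    have h0 : 0 < ∏ j, ℓ j := Finset.prod_pos fun j _ => h.1 j
    refine hμ.fref_rectangle_le hp x h.1 (by norm_num) fun j => ?_
    refine (side_le_of_ratio_le (by omega) h.1 (hratio h) j).trans ?_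
    gcongr
    calc (∏ j, ℓ j) ^ (1 / (d : ℝ)) ≤ 2 ^ (1 / (d : ℝ)) := by gcongr
      _ ≤ 2 ^ (1 : ℝ) := by
        gcongr
        · norm_num
        · rw [div_le_one (by positivity)]; linarith
      _ = 2 := Real.rpow_one 2
  have hmain : ∀ (n : ℕ) (x : EuclideanSpace ℝ (Fin d)) {ℓ : Fin d → ℝ}, ModerateAspectRatio ℓ →
      1 ≤ ∏ j, ℓ j → ∏ j, ℓ j ≤ 2 ^ (n + 1) → fref P μ p (rectangle x ℓ) ^ (1 / p) ≤
        ENNReal.ofReal (a + K - K * (∏ j, ℓ j) ^ (-β)) := by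
    intro n
    induction n with
    | zero =>
      intro x ℓ h h1 h2
      refine (hsmall x h (by simpa using h2)).trans (ENNReal.ofReal_le_ofReal ?_)
      linarith [hKle h1]
    | succ n ih =>
      intro x ℓ h h1 h2
      rcases le_total (∏ j, ℓ j) 2 with h3 | h3
      · refine (hsmall x h h3).trans (ENNReal.ofReal_le_ofReal ?_)
        linarith [hKle h1]
      -- Halving the longest side preserves the ratio bound 2: the half is at most every other side
      -- and at least half of it.
      obtain ⟨i, hi⟩ := Finite.exists_max ℓ
      have hpi := h.1 i
      have hV1 : 1 ≤ 1 / 2 * ∏ j, ℓ j := by linarith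
      have hmod : ModerateAspectRatio (Function.update ℓ i (1 / 2 * ℓ i)) := by
        refine ⟨update_pos h.1 (by positivity), fun j k => ?_⟩
        rw [div_le_iff₀ (update_pos h.1 (by positivity) k)]
        have hjk := (div_le_iff₀ (h.1 k)).1 (h.2 j k)
        have hik := (div_le_iff₀ (h.1 k)).1 (h.2 i k)
        have := h.1 k
        have := hi j
        rcases eq_or_ne j i with rfl | hj <;> rcases eq_or_ne k j with rfl | hk
        · simp only [Function.update_self]; linarith
        · simp only [Function.update_self, Function.update_of_ne hk]; linarith
        · simp only [Function.update_of_ne hj]; linarith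
        · rcases eq_or_ne k i with rfl | hk'
          · simp only [Function.update_self, Function.update_of_ne hj]; linarith
          · simp only [Function.update_of_ne hj, Function.update_of_ne hk']; linarith
      have hchild : ∀ y : EuclideanSpace ℝ (Fin d),
          fref P μ p (rectangle y (Function.update ℓ i (1 / 2 * ℓ i))) ^ (1 / p) ≤
          0 + ENNReal.ofReal (a + K - K * (1 / 2 * ∏ j, ℓ j) ^ (-β)) := by
        intro y
        have := ih y hmod (by rwa [prod_update_mul]) (by
          rw [prod_update_mul]
          rw [pow_succ] at h2
          linarith)
        rwa [prod_update_mul, ← zero_add (ENNReal.ofReal _)] at this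
      have := hstep hμ x h.1 (hratio h) i (θ := 1 / 2) (A := a + K) (B := 0) (by norm_num)
        (by norm_num) hV1 ((hKle hV1).trans (le_add_of_nonneg_left (by positivity))) (hchild x) (by
          rw [show (1 : ℝ) - 1 / 2 = 1 / 2 by norm_num]
          exact hchild _)
      simpa using this
  intro x ℓ h
  rcases le_total (∏ j, ℓ j) 1 with h1 | h1
  · exact (hsmall x h (by linarith)).trans (ENNReal.ofReal_le_ofReal (by linarith))
  · obtain ⟨n, hn⟩ := pow_unbounded_of_one_lt (∏ j, ℓ j) (one_lt_two : (1 : ℝ) < 2)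
    refine (hmain n x h h1 (hn.le.trans (pow_le_pow_right₀ one_le_two n.le_succ))).trans
      (ENNReal.ofReal_le_ofReal ?_)
    have : 0 ≤ K * (∏ j, ℓ j) ^ (-β) := by positivity
    linarith

/-- Near-subadditivity, for the `p`-th roots. -/
theorem exists_fref_root_le (hd : 3 ≤ d) {p : ℝ} (hp : 1 ≤ p) :
    ∃ K : ℝ, 0 < K ∧ ∀ {Ω : Type*} [MeasurableSpace Ω] {P : Measure Ω} [IsProbabilityMeasure P]
      {μ : Ω → Measure (EuclideanSpace ℝ (Fin d))}, IsPoissonPointProcess P μ →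
      ∀ {L : ℝ} {m : ℕ}, 1 ≤ L → 1 ≤ m →
        fref P μ p (cube d (m * L)) ^ (1 / p) ≤
          fref P μ p (cube d L) ^ (1 / p) + ENNReal.ofReal (K / L ^ (((d : ℝ) - 2) / 2)) := by
  have hd' : (3 : ℝ) ≤ d := by exact_mod_cast hd
  have : Nonempty (Fin d) := ⟨⟨0, by omega⟩⟩
  obtain ⟨K, hK, hstep⟩ := exists_fref_potential_step hd hp
  refine ⟨K, hK, ?_⟩
  intro Ω _ P _ μ hμ L m hL hm
  have hp1 : 0 ≤ 1 / p := by positivity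
  have hL0 : 0 < L := by linarith
  set β : ℝ := 1 / 2 - 1 / d with hβ
  have hβ0 : 0 < β := by
    rw [hβ, sub_pos]
    exact one_div_lt_one_div_of_lt two_pos (by linarith)
  -- dβ = (d - 2)/2, so the claimed error is the potential term of a single cell.
  have hLβ : K / L ^ (((d : ℝ) - 2) / 2) = K * (L ^ d) ^ (-β) := by
    rw [← Real.rpow_natCast L d, ← Real.rpow_mul hL0.le, div_eq_mul_inv, ← Real.rpow_neg hL0.le]
    congr 2
    rw [hβ]
    field_simp
  rw [hLβ]
  set A := K * (L ^ d) ^ (-β) with hA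
  have hvol : ∀ {n : Fin d → ℕ}, (∀ j, 1 ≤ n j) → L ^ d ≤ ∏ j, (n j : ℝ) * L := by
    intro n hn
    calc L ^ d = ∏ _j : Fin d, L := by simp
      _ ≤ ∏ j, (n j : ℝ) * L := Finset.prod_le_prod (fun _ _ => hL0.le) fun j _ =>
          le_mul_of_one_le_left hL0.le (by exact_mod_cast hn j)
  -- Induction over blocks of grid cells, on the sum of their side lengths in units of L. The
  -- potential vanishes on a cell and stays nonnegative since every block has volume at least L^d.
  have hmain : ∀ (N : ℕ) (x : EuclideanSpace ℝ (Fin d)) (n : Fin d → ℕ), ∑ j, n j ≤ N →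
      (∀ j, 1 ≤ n j) → (∀ i j, n i ≤ 3 * n j) →
      fref P μ p (rectangle x fun j => (n j : ℝ) * L) ^ (1 / p) ≤
        fref P μ p (cube d L) ^ (1 / p) +
          ENNReal.ofReal (A - K * (∏ j, (n j : ℝ) * L) ^ (-β)) := by
    intro N
    induction N with
    | zero =>
      intro x n hN hn _
      obtain ⟨i⟩ := ‹Nonempty (Fin d)›
      have := (Finset.single_le_sum (fun j _ => Nat.zero_le (n j)) (Finset.mem_univ i)).trans hN
      have := hn i
      omega
    | succ N ih =>
      intro x n hN hn hr
      obtain ⟨i, hi⟩ := Finite.exists_max n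
      rcases Nat.lt_or_ge (n i) 2 with h2 | h2
      · have h1 : (fun j => (n j : ℝ) * L) = fun _ => L := by
          ext j
          have : n j = 1 := le_antisymm ((hi j).trans (by omega)) (hn j)
          simp [this]
        rw [h1]
        refine le_add_right (ENNReal.rpow_le_rpow ?_ hp1)
        exact hμ.fref_rectangle_translate_le hp x fun _ => hL0
      set ℓ : Fin d → ℝ := fun j => (n j : ℝ) * L with hℓ
      have hni : (0 : ℝ) < n i := by exact_mod_cast hn i
      have hup : ∀ (k : ℕ) (t : ℝ), t * n i = k →
          Function.update ℓ i (t * ℓ i) = fun j => ((Function.update n i k j : ℕ) : ℝ) * L := by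
        intro k t ht
        ext j
        rcases eq_or_ne j i with rfl | hj
        · simp only [Function.update_self, hℓ]
          rw [← mul_assoc, ht]
        · simp [hj, hℓ]
      have hupd : ∀ (k : ℕ) (t : ℝ), t * n i = k → 1 ≤ k → k < n i → n i ≤ 3 * k →
          (∀ y, fref P μ p (rectangle y (Function.update ℓ i (t * ℓ i))) ^ (1 / p) ≤
            fref P μ p (cube d L) ^ (1 / p) +
              ENNReal.ofReal (A - K * (t * ∏ j, ℓ j) ^ (-β))) ∧ L ^ d ≤ t * ∏ j, ℓ j := by
        intro k t ht hk hki hk3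
        have hn' : ∀ j, 1 ≤ Function.update n i k j := by
          intro j
          rcases eq_or_ne j i with rfl | hj
          · simpa using hk
          · simpa [hj] using hn j
        have hr' : ∀ j l, Function.update n i k j ≤ 3 * Function.update n i k l := by
          intro j l
          have := hr j l
          have := hr i l
          have := hi j
          simp only [Function.update_apply]
          split_ifs <;> omega
        have hsum : ∑ j, Function.update n i k j ≤ N := by
          have : ∑ j, Function.update n i k j < ∑ j, n j :=
            Finset.sum_lt_sum (fun j _ => by
              rcases eq_or_ne j i with rfl | hj
              · simpa using hki.le
              · simp [hj]) ⟨i, Finset.mem_univ i, by simpa using hki⟩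
          omega
        rw [← prod_update_mul i ℓ t, hup k t ht]
        exact ⟨fun y => ih y _ hsum hn' hr', hvol hn'⟩
      -- The cut must follow the grid, so an odd length is not halved exactly. For n ≥ 2 one has n ≤
      -- 3⌊n/2⌋, with equality at n = 3; this is why ratios up to 3 and fractions in [1/3, 2/3] are
      -- allowed.
      set h := n i / 2 with hh
      have hhl : h ≤ n i := Nat.div_le_self _ _
      set θ : ℝ := h / n i with hθ
      have hθ1 : θ * n i = h := by rw [hθ]; field_simp
      have hθ2 : (1 - θ) * n i = (n i - h : ℕ) := by
        rw [Nat.cast_sub hhl, sub_mul, hθ1, one_mul]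
      obtain ⟨b₁, v₁⟩ := hupd h θ hθ1 (by omega) (by omega) (by omega)
      obtain ⟨b₂, -⟩ := hupd (n i - h) (1 - θ) hθ2 (by omega) (by omega) (by omega)
      have h3 : n i ≤ 3 * h := by omega
      have h3' : 3 * h ≤ 2 * n i := by omega
      have h3r : (n i : ℝ) ≤ 3 * h := by exact_mod_cast h3
      have h3r' : 3 * (h : ℝ) ≤ 2 * n i := by exact_mod_cast h3'
      refine hstep hμ x (ℓ := ℓ) (fun j => ?_) (fun j l => ?_) i (θ := θ) ?_ ?_
        ((one_le_pow₀ hL).trans v₁) ?_ (b₁ x) (b₂ _)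
      · have : (0 : ℝ) < n j := by exact_mod_cast hn j
        positivity
      · have : (n j : ℝ) ≤ 3 * n l := by exact_mod_cast hr j l
        calc (n j : ℝ) * L ≤ 3 * n l * L := by gcongr
          _ = _ := by rw [mul_assoc]
      · rw [hθ, div_le_div_iff₀ three_pos hni]
        linarith
      · rw [hθ, div_le_div_iff₀ hni three_pos]
        linarith
      · rw [hA]
        gcongr K * ?_
        exact Real.rpow_le_rpow_of_nonpos (by positivity) v₁ (by linarith)
  refine (hmain (∑ _j : Fin d, m) 0 (fun _ => m) le_rfl (fun _ => hm) fun _ _ => by omega).trans ?_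
  gcongr
  have : 0 ≤ K * (∏ _j : Fin d, (m : ℝ) * L) ^ (-β) := by positivity
  linarith

/-- By convexity, t ↦ t^p lies above its tangent at v + ε; this is Bernoulli's inequality at v / (v
+ ε). -/
theorem add_rpow_le_rpow_add {p v ε M : ℝ} (hp : 1 ≤ p) (hv : 0 ≤ v) (hε : 0 ≤ ε)
    (hM : v + ε ≤ M) : (v + ε) ^ p ≤ v ^ p + p * M ^ (p - 1) * ε := by
  rcases (add_nonneg hv hε).eq_or_lt with h0 | h0
  · have hv0 : v = 0 := by linarith
    have hε0 : ε = 0 := by linarith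
    simp [hv0, hε0]
  set w := v + ε with hw
  have hb := one_add_mul_self_le_rpow_one_add (s := -ε / w) (by
    rw [le_div_iff₀ h0]; linarith) hp
  have e : 1 + -ε / w = v / w := by field_simp; rw [hw]; ring
  rw [e, Real.div_rpow hv h0.le, le_div_iff₀ (by positivity)] at hb
  have e2 : (1 + p * (-ε / w)) * w ^ p = w ^ p - p * w ^ (p - 1) * ε := by
    rw [Real.rpow_sub_one h0.ne']
    field_simp
    ring
  have h1 : p * w ^ (p - 1) * ε ≤ p * M ^ (p - 1) * ε := by
    gcongr
  linarith

end Multiscale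

end PoissonMatching

/-! ### From roots back to p-th powers -/

theorem mainTheorem5 (d : ℕ) (hd : 3 ≤ d) (p : ℝ) (hp : 1 ≤ p) :
    ∃ C : ℝ, 0 < C ∧
      ∀ (Ω : Type*) [MeasurableSpace Ω] (P : Measure Ω) [IsProbabilityMeasure P]
        (μ : Ω → Measure (EuclideanSpace ℝ (Fin d))),
        PoissonMatching.IsPoissonPointProcess P μ →
          -- near-subadditivity on cubes
          (∀ (L : ℝ) (m : ℕ), 1 ≤ L → 1 ≤ m →
            PoissonMatching.fref P μ p (PoissonMatching.cube d (m * L)) ≤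
              PoissonMatching.fref P μ p (PoissonMatching.cube d L) +
                ENNReal.ofReal (C / L ^ (((d : ℝ) - 2) / 2))) ∧
          -- on rectangles of moderate aspect ratio the cost is a random variable,
          -- and its expectation is bounded uniformly
          (∀ (x : EuclideanSpace ℝ (Fin d)) (ℓ : Fin d → ℝ),
            PoissonMatching.ModerateAspectRatio ℓ →
              AEMeasurable (fun ω =>
                PoissonMatching.refCost p (PoissonMatching.rectangle x ℓ) (μ ω)) P ∧
              PoissonMatching.fref P μ p (PoissonMatching.rectangle x ℓ) ≤ ENNReal.ofReal C) := by
  have hp0 : 0 < p := by linarith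
  have hd' : (3 : ℝ) ≤ d := by exact_mod_cast hd
  obtain ⟨A, hA, hbound⟩ := PoissonMatching.exists_fref_le hd hp
  obtain ⟨K, hK, hsub⟩ := PoissonMatching.exists_fref_root_le hd hp
  have hcancel : ∀ s : ℝ≥0∞, (s ^ (1 / p)) ^ p = s := fun s => by
    rw [← ENNReal.rpow_mul, one_div_mul_cancel hp0.ne', ENNReal.rpow_one]
  -- A^p serves the uniform bound. The other term is the slope of t ↦ t^p at A + K times the error
  -- constant K; A + K bounds the root plus its error since L ≥ 1.
  refine ⟨A ^ p + p * (A + K) ^ (p - 1) * K, by positivity, ?_⟩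
  intro Ω _ P _ μ hμ
  refine ⟨fun L m hL hm => ?_, fun x ℓ hℓ => ⟨hμ.aemeasurable_refCost hp x hℓ.1, ?_⟩⟩
  · have hL0 : 0 < L := by linarith
    have hLe : 1 ≤ L ^ (((d : ℝ) - 2) / 2) := Real.one_le_rpow hL (by linarith)
    set ε := K / L ^ (((d : ℝ) - 2) / 2) with hε
    have hε0 : 0 ≤ ε := by positivity
    have hεK : ε ≤ K := div_le_self hK.le hLe
    have h1 := hsub hμ hL hm
    have h2 : PoissonMatching.fref P μ p (PoissonMatching.cube d L) ^ (1 / p) ≤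
        ENNReal.ofReal A :=
      hbound hμ 0 ⟨fun _ => hL0, fun _ _ => by rw [div_self hL0.ne']; norm_num⟩
    rw [← hcancel (PoissonMatching.fref P μ p (PoissonMatching.cube d L)),
      ← hcancel (PoissonMatching.fref P μ p (PoissonMatching.cube d (m * L)))]
    set u := PoissonMatching.fref P μ p (PoissonMatching.cube d L) ^ (1 / p)
    have hu : u = ENNReal.ofReal u.toReal :=
      (ENNReal.ofReal_toReal (ne_top_of_le_ne_top ENNReal.ofReal_ne_top h2)).symm
    have hv0 : 0 ≤ u.toReal := ENNReal.toReal_nonneg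
    have hvA : u.toReal ≤ A := ENNReal.toReal_le_of_le_ofReal hA.le h2
    generalize u.toReal = v at hu hv0 hvA
    rw [hu, ← ENNReal.ofReal_add hv0 hε0] at h1
    refine (ENNReal.rpow_le_rpow h1 hp0.le).trans ?_
    rw [hu, ENNReal.ofReal_rpow_of_nonneg (by positivity) hp0.le,
      ENNReal.ofReal_rpow_of_nonneg hv0 hp0.le, ← ENNReal.ofReal_add (by positivity)
      (by positivity)]
    refine ENNReal.ofReal_le_ofReal
      ((PoissonMatching.add_rpow_le_rpow_add hp hv0 hε0 (add_le_add hvA hεK)).trans ?_)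
    rw [hε, ← mul_div_assoc]
    gcongr
    exact le_add_of_nonneg_left (by positivity)
  · rw [← hcancel (PoissonMatching.fref P μ p (PoissonMatching.rectangle x ℓ))]
    refine (ENNReal.rpow_le_rpow (hbound hμ x hℓ) hp0.le).trans ?_
    rw [ENNReal.ofReal_rpow_of_nonneg hA.le hp0.le]
    exact ENNReal.ofReal_le_ofReal (le_add_of_nonneg_right (by positivity))
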